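/- For $0<\phi<\pi/2$ and $\eta>0$ let $\Delta(\phi,\eta)=\{z\in\mathbb{C}: |z|<1+\eta,\ |\operatorname{Arg}(z-1)|>\phi\}$. Call $f$ $\Delta$-regular in $\Delta(\phi,\eta)$ if its Taylor series $\sum_{n\ge0} f_nz^n$ at $0$ has radius of convergence $1$ and $f$ is analytic in $\Delta(\phi,\eta)$. The Hadamard product of $f(z)=\sum_n f_nz^n$ and $g(z)=\sum_n g_nz^n$ is $(f\odot g)(z)=\sum_{n\ge0} f_ng_nz^n$. Put $L(z)=\log\frac1{1-z}$ (principal branch). Let $f,g$ be $\Delta$-regular in $\Delta=\Delta(\phi,\eta)$, and let $a,b$ be real numbers with $a+b+1>-1$ such that, uniformly for $z\in\Delta$, $f(z)=O(|1-z|^a)$ and $g(z)=O(|1-z|^b)$. Then there is a (possibly smaller) domain $\Delta'=\Delta(\phi',\eta')\subseteq\Delta$, with $\phi\le\phi'<\pi/2$ and $0<\eta'\le\eta$, to which $f\odot g$ continues analytically, such that the following holds, where $(f\odot g)^{(j)}(1)$ denotes the limit of $(f\odot g)^{(j)}(z)$ as $z\to1$ in $\Delta'$. (i) If $k<a+b+1<k+1$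 for some integer $k\ge-1$, then $(f\odot g)^{(j)}(1)$ exists for $0\le j\le k$ and, uniformly for $z\in\Delta'$, $$(f\odot g)(z)=\sum_{j=0}^{k}\frac{(-1)^j}{j!}(f\odot g)^{(j)}(1)\,(1-z)^j+O\left(|1-z|^{a+b+1}\right).$$ (ii) If $a+b+1$ is a nonnegative integer, then $(f\odot g)^{(j)}(1)$ exists for $0\le j\le a+b$ and, for every $r>0$, uniformly for $z\in\Delta'$ with $|z|\ge r$, $$(f\odot g)(z)=\sum_{j=0}^{a+b}\frac{(-1)^j}{j!}(f\odot g)^{(j)}(1)\,(1-z)^j+O\left(|1-z|^{a+b+1}|L(z)|\right).$$ (Empty sums are $0$.) -/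

import Mathlib

open Filter Topology Asymptotics

namespace HadamardSing

/-- The domain `Δ(φ, η) = {z : |z| < 1 + η, |Arg (z - 1)| > φ}`.  As `Complex.arg 0 = 0`, it does
not contain the point `1` when `0 ≤ φ`. -/
def deltaDomain (φ η : ℝ) : Set ℂ :=
  {z : ℂ | ‖z‖ < 1 + η ∧ φ < |Complex.arg (z - 1)|}

/-- The `n`-th Taylor coefficient at the origin, `[zⁿ] f(z)`. -/
noncomputable def taylorCoeff (f : ℂ → ℂ) (n : ℕ) : ℂ :=
  iteratedDeriv n f 0 / (n.factorial : ℂ)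

/-- `f` is `Δ`-regular in `Δ(φ, η)`: its Taylor series at the origin has radius of convergence
equal to `1`, and `f` is analytic on `Δ(φ, η)` (a set that contains the open unit disc). The values
of `f` outside `Δ(φ, η)` play no role. -/
structure IsDeltaRegular (f : ℂ → ℂ) (φ η : ℝ) : Prop where
  eta_pos : 0 < η
  phi_pos : 0 < φ
  phi_lt : φ < Real.pi / 2
  radius_eq : (FormalMultilinearSeries.ofScalars ℂ (taylorCoeff f)).radius = 1
  analytic : AnalyticOnNhd ℂ f (deltaDomain φ η)

/-- The function `h` is (the analytic continuation to `D` of) the Hadamard product `f ⊙ g`: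
it is analytic on `D` and on the open unit disc it is the sum of `∑ fₙ gₙ zⁿ`. -/
structure IsHadamardProductOn (f g h : ℂ → ℂ) (D : Set ℂ) : Prop where
  analytic : AnalyticOnNhd ℂ h D
  hasSum : ∀ z ∈ Metric.ball (0 : ℂ) 1,
    HasSum (fun n : ℕ => taylorCoeff f n * taylorCoeff g n * z ^ n) (h z)

/-- `d` is the value `h⁽ʲ⁾(1)` at the boundary point `1` of `D`: the limit of the `j`-th derivative
of `h` as `z → 1` within `D`. -/
def HasDerivValueAtOne (h : ℂ → ℂ) (D : Set ℂ) (j : ℕ) (d : ℂ) : Prop :=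
  Tendsto (iteratedDeriv j h) (𝓝[D] 1) (𝓝 d)

/-- The Taylor polynomial at `1` with the `m` derivatives `d 0, …, d (m - 1)`:
`∑_{j < m} (-1)ʲ / j! * d j * (1 - z)ʲ`. -/
noncomputable def taylorPolyAtOne (d : ℕ → ℂ) (m : ℕ) (z : ℂ) : ℂ :=
  ∑ j ∈ Finset.range m, (-1) ^ j / (j.factorial : ℂ) * d j * (1 - z) ^ j

/-- `L(z) = log (1 / (1 - z))`, principal branch. -/
noncomputable def L (z : ℂ) : ℂ := Complex.log (1 / (1 - z))

end HadamardSing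

namespace HadamardSing

open MeasureTheory

/-! The proof rests on Hadamard's integral `(f ⊙ g)(z) = (2πi)⁻¹ ∮ f(w) g(z/w) dw/w`. Since `a + b >
-2`, one of `a`, `b` exceeds `-1`; by symmetry let it be `a`. Then `f` is integrable along a contour
through its own singularity, and the contour is taken to be `w(θ) = exp(κ sin(θ/2) + iθ)`, `0 < θ <
2π`. It leaves and re-enters `1` at an angle, stays in `Δ` with `|w| ≥ 1`, and `|1 - w|` is
comparable to `s = sin(θ/2)`.

For `z` in a smaller domain `Δ'`, the quotient `z/w` remains in `Δ` and `|1 - z/w|` is comparable to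
`|1 - z| + s` (`add_sin_le_norm_one_sub_div_spiral`, `norm_one_sub_div_spiral_le`). The integral
therefore continues `f ⊙ g` to `Δ'`. Cauchy estimates for `g` bound its `j`-th derivative by a
multiple of `∫ s^a (|1 - z| + s)^(b - j) dθ`. With `q = a + b + 1`, the derivative has a limit at
`1` when `j < q`, is `O(|1 - z|^(q - j))` when `j > q`, and is logarithmic when `j = q`.

It remains to take the first `j ≥ q` and integrate that bound `j` times along segments ending at
`1`. The limits of the lower derivatives supply the Taylor polynomial
(`exists_norm_sub_taylorPolyAtOne_le`). That the integral is the Hadamard product follows from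
Cauchy's coefficient formula on the singular contour, obtained by deforming a small circle, and from
termwise integration of the series of `g`. -/

/-! ### Domains with a corner at `1`. -/

/-- The domain `Δ(φ, η)` described through `c = cos φ`. -/
def coneDomain (c η : ℝ) : Set ℂ :=
  {z : ℂ | ‖z‖ < 1 + η ∧ z.re - 1 < c * ‖z - 1‖}

/-- Cosine is strictly decreasing on `[0, π]` and `cos (arg (z - 1)) = Re (z - 1) / |z - 1|`. The
resulting inequality is branch-free and visibly open. -/
lemma deltaDomain_eq_coneDomain {φ η : ℝ} (h0 : 0 ≤ φ) (hpi : φ ≤ Real.pi) :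
    deltaDomain φ η = coneDomain (Real.cos φ) η := by
  ext z
  simp only [deltaDomain, coneDomain, Set.mem_ofPred_eq]
  refine and_congr_right fun _ => ?_
  rcases eq_or_ne (z - 1) 0 with h | h
  · have hz : z = 1 := by linear_combination h
    subst hz
    simp [h0]
  · rw [← Real.strictAntiOn_cos.lt_iff_gt ⟨abs_nonneg _, Complex.abs_arg_le_pi _⟩ ⟨h0, hpi⟩,
      Real.cos_abs, Complex.cos_arg h, div_lt_iff₀ (norm_pos_iff.2 h)]
    simp

lemma isOpen_coneDomain (c η : ℝ) : IsOpen (coneDomain c η) := by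
  refine IsOpen.and (isOpen_lt (by fun_prop) (by fun_prop)) (isOpen_lt (by fun_prop) (by fun_prop))

lemma ball_subset_coneDomain {c η : ℝ} (hc : 0 ≤ c) (hη : 0 ≤ η) :
    Metric.ball (0 : ℂ) 1 ⊆ coneDomain c η := by
  intro z hz
  have hz' : ‖z‖ < 1 := by simpa using hz
  refine ⟨by linarith, ?_⟩
  have := Complex.re_le_norm z
  have : 0 ≤ c * ‖z - 1‖ := by positivity
  linarith

lemma one_notMem_coneDomain (c η : ℝ) : (1 : ℂ) ∉ coneDomain c η := by
  simp [coneDomain]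

lemma norm_one_sub_pos {c η : ℝ} {z : ℂ} (hz : z ∈ coneDomain c η) : 0 < ‖1 - z‖ := by
  rw [norm_pos_iff, sub_ne_zero]
  rintro rfl
  exact one_notMem_coneDomain _ _ hz

lemma coneDomain_mono {c c' η η' : ℝ} (hc : c ≤ c') (hη : η ≤ η') :
    coneDomain c η ⊆ coneDomain c' η' := by
  intro z hz
  refine ⟨by linarith [hz.1], hz.2.trans_le ?_⟩
  gcongr

/-- `coneDomain c η` is star-shaped with respect to the boundary point `1`. -/
lemma segment_mem_coneDomain {c η t : ℝ} {z : ℂ} (hη : 0 < η)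
    (hz : z ∈ coneDomain c η) (ht : 0 < t) (ht1 : t ≤ 1) :
    1 + (t : ℂ) * (z - 1) ∈ coneDomain c η := by
  constructor
  · have h : 1 + (t : ℂ) * (z - 1) = ((1 - t : ℝ) : ℂ) + (t : ℂ) * z := by push_cast; ring
    rw [h]
    calc _ ≤ ‖((1 - t : ℝ) : ℂ)‖ + ‖(t : ℂ) * z‖ := norm_add_le _ _
      _ = (1 - t) + t * ‖z‖ := by
        rw [norm_mul, Complex.norm_of_nonneg (by linarith), Complex.norm_of_nonneg ht.le]
      _ < 1 + η := by nlinarith [hz.1]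
  · have h2 := hz.2
    have : ‖1 + (t : ℂ) * (z - 1) - 1‖ = t * ‖z - 1‖ := by
      rw [add_sub_cancel_left, norm_mul, Complex.norm_of_nonneg ht.le]
    rw [this]
    simp only [Complex.add_re, Complex.one_re, Complex.re_ofReal_mul, Complex.sub_re]
    nlinarith

/-! ### Geometry in logarithmic coordinates: the contour and the quotients `z / w`. -/

/-- Separates the distance from `1` into a radial and an angular part. The angular part involves
only `sin² (v.im / 2)`, which is `2π`-periodic, so no branch of the logarithm matters. -/
lemma norm_one_sub_exp_sq (v : ℂ) : ‖1 - Complex.exp v‖ ^ 2 =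
    (1 - Real.exp v.re) ^ 2 + 4 * Real.exp v.re * Real.sin (v.im / 2) ^ 2 := by
  rw [← Complex.normSq_eq_norm_sq, Complex.normSq_apply]
  simp only [Complex.sub_re, Complex.one_re, Complex.sub_im, Complex.one_im, Complex.exp_re,
    Complex.exp_im]
  have h1 : Real.cos v.im = 1 - 2 * Real.sin (v.im / 2) ^ 2 := by
    rw [← Real.cos_two_mul_eq_one_sub]
    ring_nf
  have h2 := Real.sin_sq_add_cos_sq v.im
  have h3 : Real.sin v.im ^ 2 = 1 - (1 - 2 * Real.sin (v.im / 2) ^ 2) ^ 2 := by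
    rw [← h1]; linarith
  rw [h1]
  linear_combination Real.exp v.re ^ 2 * h3

lemma two_mul_abs_sin_le_norm_one_sub_exp {v : ℂ} (hv : 0 ≤ v.re) :
    2 * |Real.sin (v.im / 2)| ≤ ‖1 - Complex.exp v‖ := by
  refine le_of_sq_le_sq ?_ (norm_nonneg _)
  rw [norm_one_sub_exp_sq, mul_pow, sq_abs]
  have := Real.one_le_exp hv
  nlinarith [sq_nonneg (1 - Real.exp v.re), sq_nonneg (Real.sin (v.im / 2))]

lemma exp_mem_coneDomain {κ c η : ℝ} {v : ℂ} (h0 : 0 < κ) (h1 : κ ≤ 1) (hc : κ ≤ c)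
    (hη : 2 * κ ≤ η) (hv : v.re < κ * |Real.sin (v.im / 2)|) :
    Complex.exp v ∈ coneDomain c η := by
  have hσ1 : |Real.sin (v.im / 2)| ≤ 1 := Real.abs_sin_le_one _
  have hσ0 := abs_nonneg (Real.sin (v.im / 2))
  set σ := |Real.sin (v.im / 2)| with hσ
  have hexp : Real.exp (κ * σ) ≤ 1 + 2 * (κ * σ) := by
    have h : |κ * σ| ≤ 1 := by rw [abs_of_nonneg (by positivity)]; nlinarith
    have := Real.abs_exp_sub_one_le h
    rw [abs_of_nonneg (show 0 ≤ κ * σ by positivity)] at this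
    linarith [le_abs_self (Real.exp (κ * σ) - 1)]
  have hlt := Real.exp_lt_exp.2 hv
  have hre := Complex.re_le_norm (Complex.exp v)
  rw [Complex.norm_exp] at hre
  refine ⟨?_, ?_⟩
  · rw [Complex.norm_exp]; nlinarith
  · rw [norm_sub_rev]
    rcases lt_or_ge v.re 0 with h | h
    · have : Real.exp v.re < 1 := by simpa using h
      have : 0 ≤ c * ‖1 - Complex.exp v‖ := mul_nonneg (h0.le.trans hc) (norm_nonneg _)
      linarith
    · have := two_mul_abs_sin_le_norm_one_sub_exp h
      have : κ * (2 * σ) ≤ c * ‖1 - Complex.exp v‖ :=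
        mul_le_mul hc this (by positivity) (h0.le.trans hc)
      linarith

/-- In logarithmic coordinates, a closed region with a corner at the origin. -/
def spiralSet (κ : ℝ) : Set ℂ :=
  {z : ℂ | z = 0 ∨ ∃ v : ℂ, Complex.exp v = z ∧ v.re ≤ κ * |Real.sin (v.im / 2)|}

lemma one_mem_spiralSet (κ : ℝ) : (1 : ℂ) ∈ spiralSet κ := Or.inr ⟨0, by simp⟩

lemma coneDomain_subset_spiralSet {κ : ℝ} (h0 : 0 < κ) (h1 : κ ≤ 1) :
    coneDomain (κ / 16) (κ ^ 2 / 16) ⊆ spiralSet κ := by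
  intro z hz
  rcases eq_or_ne z 0 with h | h
  · exact Or.inl h
  refine Or.inr ⟨Complex.log z, Complex.exp_log h, ?_⟩
  have hsq := norm_one_sub_exp_sq (Complex.log z)
  rw [Complex.exp_log h, Complex.log_im, Complex.log_re, Real.exp_log (norm_pos_iff.2 h)] at hsq
  rw [Complex.log_im, Complex.log_re]
  obtain ⟨hz1, hz2⟩ := hz
  have hσ0 := abs_nonneg (Real.sin (z.arg / 2))
  rw [← sq_abs (Real.sin _)] at hsq
  have hre : z.re = ‖z‖ * (1 - 2 * |Real.sin (z.arg / 2)| ^ 2) := by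
    rw [sq_abs, ← Real.cos_two_mul_eq_one_sub, mul_div_cancel₀ _ two_ne_zero, Complex.norm_mul_cos_arg]
  set σ := |Real.sin (z.arg / 2)| with hσ
  rcases le_or_gt ‖z‖ 1 with hr | hr
  · have := Real.log_nonpos (norm_nonneg z) hr
    have : 0 ≤ κ * σ := by positivity
    linarith
  have hlog := Real.log_le_sub_one_of_pos (norm_pos_iff.2 h)
  rw [norm_sub_rev, hre] at hz2
  set r := ‖z‖
  have hr2 : r ≤ 2 := by nlinarith
  have hn : ‖1 - z‖ ≤ (r - 1) + 2 * r * σ := by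
    refine le_of_sq_le_sq ?_ (by nlinarith)
    rw [hsq]
    nlinarith [mul_nonneg (sub_nonneg.2 hr.le) hσ0, mul_nonneg (sq_nonneg σ) (sub_nonneg.2 hr.le),
      mul_nonneg (mul_nonneg (sq_nonneg σ) (sub_nonneg.2 hr.le)) (by linarith : 0 ≤ r),
      mul_nonneg (mul_nonneg (sub_nonneg.2 hr.le) hσ0) (by linarith : 0 ≤ r)]
  have key : r - 1 ≤ 8 * σ * (σ + κ / 16) := by
    have h3 : κ / 16 * ‖1 - z‖ ≤ κ / 16 * ((r - 1) + 2 * r * σ) := by gcongr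
    have h4 : κ / 16 * (r - 1) ≤ 1 / 2 * (r - 1) := by
      apply mul_le_mul_of_nonneg_right _ (by linarith); linarith
    have h5 : 2 * r * (σ * (σ + κ / 16)) ≤ 2 * 2 * (σ * (σ + κ / 16)) := by
      apply mul_le_mul_of_nonneg_right _ (by positivity); linarith
    nlinarith
  -- If `σ ≤ κ/16`, `key` gives `r - 1 ≤ 8σ · κ/8 = κσ`. Otherwise the norm bound gives `r - 1 <
  -- κ²/16 < κσ`.
  rcases le_or_gt σ (κ / 16) with h6 | h6
  · nlinarith
  · nlinarith

/-- The contour `θ ↦ exp (κ sin (θ / 2) + i θ)`, which touches the point `1` at an angle. -/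
noncomputable def spiral (κ θ : ℝ) : ℂ :=
  Complex.exp ((κ * Real.sin (θ / 2) : ℝ) + θ * Complex.I)

lemma sin_half_pos {θ : ℝ} (h : θ ∈ Set.Ioo 0 (2 * Real.pi)) : 0 < Real.sin (θ / 2) :=
  Real.sin_pos_of_pos_of_lt_pi (by linarith [h.1]) (by linarith [h.2])

lemma spiral_ne_zero (κ θ : ℝ) : spiral κ θ ≠ 0 := Complex.exp_ne_zero _

lemma norm_spiral (κ θ : ℝ) : ‖spiral κ θ‖ = Real.exp (κ * Real.sin (θ / 2)) := by
  rw [spiral, Complex.norm_exp]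
  simp only [Complex.ofReal_im, Complex.ofReal_re, Complex.I_im,
    mul_one, Complex.I_re, mul_zero, add_zero, Complex.add_re, Complex.mul_re, sub_zero]

lemma continuous_spiral (κ : ℝ) : Continuous (spiral κ) := by
  unfold spiral; fun_prop

lemma one_le_norm_spiral {κ θ : ℝ} (h0 : 0 ≤ κ) (h : θ ∈ Set.Ioo 0 (2 * Real.pi)) :
    1 ≤ ‖spiral κ θ‖ := by
  rw [norm_spiral]
  exact Real.one_le_exp (mul_nonneg h0 (sin_half_pos h).le)

lemma norm_spiral_le {κ : ℝ} (θ : ℝ) (h0 : 0 ≤ κ) (h1 : κ ≤ 1) : ‖spiral κ θ‖ ≤ 3 := by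
  rw [norm_spiral]
  have h : κ * Real.sin (θ / 2) ≤ 1 := by nlinarith [Real.sin_le_one (θ / 2)]
  calc _ ≤ Real.exp 1 := Real.exp_le_exp.2 h
    _ ≤ 3 := by linarith [Real.exp_one_lt_d9]

lemma two_mul_sin_le_norm_one_sub_spiral {κ θ : ℝ} (h0 : 0 ≤ κ)
    (h : θ ∈ Set.Ioo 0 (2 * Real.pi)) :
    2 * Real.sin (θ / 2) ≤ ‖1 - spiral κ θ‖ := by
  have hs := sin_half_pos h
  have := two_mul_abs_sin_le_norm_one_sub_exp
    (v := (κ * Real.sin (θ / 2) : ℝ) + θ * Complex.I) (by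
      simp only [Complex.ofReal_im, Complex.ofReal_re, Complex.I_im,
        mul_one, Complex.I_re, mul_zero, add_zero, Complex.add_re, Complex.mul_re, sub_zero]
      positivity)
  rw [spiral]
  refine le_trans ?_ this
  simp only [Complex.add_im, Complex.ofReal_im, Complex.mul_im, Complex.ofReal_re, Complex.I_im,
    mul_one, Complex.I_re, mul_zero, add_zero, zero_add]
  linarith [le_abs_self (Real.sin (θ / 2))]

lemma norm_one_sub_spiral_le {κ θ : ℝ} (h0 : 0 ≤ κ) (h1 : κ ≤ 1)
    (h : θ ∈ Set.Ioo 0 (2 * Real.pi)) :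
    ‖1 - spiral κ θ‖ ≤ 4 * Real.sin (θ / 2) := by
  have hs := sin_half_pos h
  have hs1 := Real.sin_le_one (θ / 2)
  refine le_of_sq_le_sq ?_ (by positivity)
  have hr := norm_spiral_le θ h0 h1
  rw [norm_spiral] at hr
  rw [spiral, norm_one_sub_exp_sq]
  simp only [Complex.add_im, Complex.ofReal_im, Complex.mul_im, Complex.ofReal_re, Complex.I_im,
    mul_one, Complex.I_re, mul_zero, add_zero, zero_add, Complex.add_re, Complex.mul_re, sub_zero]
  set s := Real.sin (θ / 2)
  have hexp : |Real.exp (κ * s) - 1| ≤ 2 * s := by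
    have h' : |κ * s| ≤ 1 := by rw [abs_of_nonneg (by positivity)]; nlinarith
    have := Real.abs_exp_sub_one_le h'
    rw [abs_of_nonneg (show 0 ≤ κ * s by positivity)] at this
    nlinarith
  have h2 : (Real.exp (κ * s) - 1) ^ 2 ≤ (2 * s) ^ 2 := by
    rw [← sq_abs]; gcongr
  nlinarith [sq_nonneg s, mul_le_mul_of_nonneg_right hr (sq_nonneg s)]

lemma abs_sin_sub_le (x y : ℝ) : |Real.sin x| ≤ |Real.sin y| + |Real.sin (x - y)| := by
  have h : Real.sin x = Real.sin y * Real.cos (x - y) + Real.cos y * Real.sin (x - y) := by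
    rw [← Real.sin_add]; congr 1; ring
  rw [h]
  refine (abs_add_le _ _).trans ?_
  rw [abs_mul, abs_mul]
  nlinarith [Real.abs_cos_le_one (x - y), Real.abs_cos_le_one y, abs_nonneg (Real.sin y),
    abs_nonneg (Real.sin (x - y))]

/-- The contour has slope `κ` and `z` only `κ / 2`. Subtracting logarithms and using subadditivity
of `|sin|` leaves the surplus `-(κ / 2) sin (θ / 2)`, which pushes the quotient strictly inside. -/
lemma exp_div_spiral_aux {κ θ : ℝ} {v : ℂ}
    (h : θ ∈ Set.Ioo 0 (2 * Real.pi)) (h0 : 0 < κ)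
    (hv : v.re ≤ κ / 2 * |Real.sin (v.im / 2)|) :
    ∃ u : ℂ, Complex.exp u = Complex.exp v / spiral κ θ ∧
      u.re ≤ κ / 2 * |Real.sin (u.im / 2)| - κ / 2 * Real.sin (θ / 2) := by
  refine ⟨v - ((κ * Real.sin (θ / 2) : ℝ) + θ * Complex.I), by rw [spiral, Complex.exp_sub], ?_⟩
  have hs := sin_half_pos h
  simp only [Complex.add_im, Complex.ofReal_im, Complex.mul_im, Complex.ofReal_re, Complex.I_im,
    mul_one, Complex.I_re, mul_zero, add_zero, zero_add, Complex.add_re, Complex.mul_re, sub_zero,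
    Complex.sub_re, Complex.sub_im]
  have := abs_sin_sub_le (v.im / 2) (θ / 2)
  rw [abs_of_pos hs, ← sub_div] at this
  nlinarith

lemma div_spiral_mem_coneDomain {κ c η θ : ℝ} {z : ℂ} (h0 : 0 < κ) (h1 : κ ≤ 1) (hc : κ ≤ c)
    (hη : 2 * κ ≤ η) (h : θ ∈ Set.Ioo 0 (2 * Real.pi)) (hz : z ∈ spiralSet (κ / 2)) :
    z / spiral κ θ ∈ coneDomain c η := by
  rcases hz with rfl | ⟨v, rfl, hv⟩
  · rw [zero_div]
    exact ball_subset_coneDomain (by linarith) (by linarith) (by simp)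
  · obtain ⟨u, hu, hu'⟩ := exp_div_spiral_aux h h0 hv
    rw [← hu]
    have hs := sin_half_pos h
    refine exp_mem_coneDomain h0 h1 hc hη (hu'.trans_lt ?_)
    nlinarith [abs_nonneg (Real.sin (u.im / 2))]

lemma spiral_mem_coneDomain {κ c η θ : ℝ} (h0 : 0 < κ) (h2 : 2 * κ ≤ 1) (hc : κ ≤ c / 2)
    (hη : 4 * κ ≤ η) (h : θ ∈ Set.Ioo 0 (2 * Real.pi)) :
    spiral κ θ ∈ coneDomain c η := by
  refine exp_mem_coneDomain (κ := 2 * κ) (by linarith) h2 (by linarith) (by linarith) ?_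
  have hs := sin_half_pos h
  simp only [Complex.add_im, Complex.ofReal_im, Complex.mul_im, Complex.ofReal_re, Complex.I_im,
    mul_one, Complex.I_re, mul_zero, add_zero, zero_add, Complex.add_re, Complex.mul_re, sub_zero]
  rw [abs_of_pos hs]
  nlinarith

/-- Either the quotient has small angle, and then the surplus makes its modulus smaller than `1` by
a multiple of `κ sin (θ / 2)`, or its angle alone keeps it away from `1`. -/
lemma sin_le_norm_one_sub_div_spiral {κ θ : ℝ} {z : ℂ} (h0 : 0 < κ) (h1 : κ ≤ 1)
    (h : θ ∈ Set.Ioo 0 (2 * Real.pi)) (hz : z ∈ spiralSet (κ / 2)) :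
    κ / 8 * Real.sin (θ / 2) ≤ ‖1 - z / spiral κ θ‖ := by
  have hs := sin_half_pos h
  have hs1 := Real.sin_le_one (θ / 2)
  rcases hz with rfl | ⟨v, rfl, hv⟩
  · rw [zero_div, sub_zero, norm_one]
    nlinarith
  · obtain ⟨u, hu, hu'⟩ := exp_div_spiral_aux h h0 hv
    rw [← hu]
    set s := Real.sin (θ / 2)
    rcases le_or_gt |Real.sin (u.im / 2)| (s / 2) with h2 | h2
    · have hx : u.re ≤ -(κ * s / 4) := by nlinarith
      have h3 : ‖(1 : ℂ)‖ - ‖Complex.exp u‖ ≤ ‖1 - Complex.exp u‖ := norm_sub_norm_le _ _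
      rw [norm_one, Complex.norm_exp] at h3
      refine le_trans ?_ h3
      have h4 : Real.exp u.re * (1 + κ * s / 4) ≤ 1 := by
        calc _ ≤ Real.exp (-(κ * s / 4)) * Real.exp (κ * s / 4) := by
              gcongr
              linarith [Real.add_one_le_exp (κ * s / 4)]
          _ = 1 := by rw [← Real.exp_add]; simp
      have h5 : 0 < Real.exp u.re := Real.exp_pos _
      have h6 : 0 < κ * s := by positivity
      have h7 : κ * s ≤ 1 := by nlinarith
      nlinarith
    · refine le_of_sq_le_sq ?_ (norm_nonneg _)
      rw [norm_one_sub_exp_sq, ← sq_abs (Real.sin _)]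
      have h5 : 0 < Real.exp u.re := Real.exp_pos _
      set σ := |Real.sin (u.im / 2)|
      set r := Real.exp u.re
      have h6 : 0 < κ * s := by positivity
      have h7 : κ * s ≤ s := by nlinarith
      have h8 : (κ / 8 * s) ^ 2 ≤ (s / 8) ^ 2 := by gcongr; linarith
      have h9 : (s / 2) ^ 2 ≤ σ ^ 2 := by gcongr
      refine h8.trans ?_
      rcases le_or_gt r (1 / 4) with h10 | h10
      · nlinarith [mul_nonneg h5.le (sq_nonneg σ)]
      · nlinarith [sq_nonneg (1 - r), mul_le_mul_of_nonneg_right h10.le (sq_nonneg σ)]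

/-- From `1 - z = w (1 - z / w) + (1 - w)` with `|w| ≤ 3` and `|1 - w| ≤ 4 sin (θ / 2)`. The
constant is `43 = 3 + 5 · 8`. -/
lemma add_sin_le_norm_one_sub_div_spiral {κ θ : ℝ} {z : ℂ} (h0 : 0 < κ) (h1 : κ ≤ 1)
    (h : θ ∈ Set.Ioo 0 (2 * Real.pi)) (hz : z ∈ spiralSet (κ / 2)) :
    ‖1 - z‖ + Real.sin (θ / 2) ≤ 43 / κ * ‖1 - z / spiral κ θ‖ := by
  have h2 := sin_le_norm_one_sub_div_spiral h0 h1 h hz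
  have h3 := norm_one_sub_spiral_le h0.le h1 h
  have h4 := norm_spiral_le θ h0.le h1
  set w := spiral κ θ with hw
  have hw0 : w ≠ 0 := spiral_ne_zero _ _
  have h5 : ‖1 - z‖ ≤ 3 * ‖1 - z / w‖ + 4 * Real.sin (θ / 2) := by
    have : 1 - z = w * (1 - z / w) + (1 - w) := by field_simp; ring
    rw [this]
    refine (norm_add_le _ _).trans ?_
    rw [norm_mul]
    gcongr
  have h6 : Real.sin (θ / 2) ≤ 8 / κ * ‖1 - z / w‖ := by
    rw [div_mul_eq_mul_div, le_div_iff₀ h0]; linarith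
  have h7 : 3 * ‖1 - z / w‖ ≤ 3 / κ * ‖1 - z / w‖ := by
    gcongr
    rw [le_div_iff₀ h0]; linarith
  calc _ ≤ 3 / κ * ‖1 - z / w‖ + 5 * (8 / κ * ‖1 - z / w‖) := by linarith
    _ = _ := by ring

lemma norm_one_sub_div_spiral_le {κ θ : ℝ} {z : ℂ} (h0 : 0 < κ) (h1 : κ ≤ 1)
    (h : θ ∈ Set.Ioo 0 (2 * Real.pi)) :
    ‖1 - z / spiral κ θ‖ ≤ 43 / κ * (‖1 - z‖ + Real.sin (θ / 2)) := by
  have hs := sin_half_pos h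
  have h3 := norm_one_sub_spiral_le h0.le h1 h
  have h4 := one_le_norm_spiral h0.le h
  set w := spiral κ θ with hw
  have hw0 : w ≠ 0 := spiral_ne_zero _ _
  have h5 : ‖1 - z / w‖ ≤ ‖1 - z‖ + 4 * Real.sin (θ / 2) := by
    have : 1 - z / w = ((1 - z) - (1 - w)) / w := by field_simp; ring
    rw [this, norm_div]
    refine (div_le_self (norm_nonneg _) h4).trans ((norm_sub_le _ _).trans ?_)
    gcongr
  have h6 : 43 ≤ 43 / κ := by rw [le_div_iff₀ h0]; linarith
  have h7 : 43 * (‖1 - z‖ + Real.sin (θ / 2)) ≤ 43 / κ * (‖1 - z‖ + Real.sin (θ / 2)) := by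
    gcongr
  linarith [norm_nonneg (1 - z)]

/-! ### Cauchy estimates for derivatives near the corner. -/

lemma rpow_le_of_comparable {K x y e : ℝ} (hK : 1 ≤ K) (hx : 0 < x) (hy : 0 < y)
    (hxy : x ≤ K * y) (hyx : y ≤ K * x) : x ^ e ≤ K ^ |e| * y ^ e := by
  have hK0 : 0 < K := by linarith
  rcases le_or_gt 0 e with he | he
  · rw [abs_of_nonneg he, ← Real.mul_rpow hK0.le hy.le]
    exact Real.rpow_le_rpow hx.le hxy he
  · rw [abs_of_neg he, Real.rpow_neg hK0.le, ← Real.inv_rpow hK0.le,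
      ← Real.mul_rpow (by positivity) hy.le]
    refine Real.rpow_le_rpow_of_nonpos (by positivity) ?_ he.le
    rw [inv_mul_le_iff₀ hK0]
    exact hyx

lemma mem_coneDomain_of_norm_sub_le {c η : ℝ} (hc : 0 < c) (hc1 : c ≤ 1) (hη : 0 < η)
    (hη1 : η ≤ 1) {z ζ : ℂ} (hz : z ∈ coneDomain (c / 2) (η / 2))
    (h : ‖ζ - z‖ ≤ min (c / 4) (η / 8) * ‖1 - z‖) : ζ ∈ coneDomain c η := by
  have h0 := norm_one_sub_pos hz
  have h1 : ‖ζ - z‖ ≤ c / 4 * ‖1 - z‖ := h.trans (by gcongr; exact min_le_left _ _)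
  have h2 : ‖ζ - z‖ ≤ η / 8 * ‖1 - z‖ := h.trans (by gcongr; exact min_le_right _ _)
  have h3 : ‖1 - z‖ ≤ 3 := by
    refine (norm_sub_le _ _).trans ?_
    rw [norm_one]
    linarith [hz.1]
  constructor
  · have : ‖ζ‖ ≤ ‖z‖ + ‖ζ - z‖ := norm_le_norm_add_norm_sub' _ _
    nlinarith [hz.1]
  · have h4 : ‖z - 1‖ ≤ ‖ζ - 1‖ + ‖ζ - z‖ := by
      rw [norm_sub_rev ζ z]
      have : z - 1 = (ζ - 1) + (z - ζ) := by ring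
      rw [this]
      exact norm_add_le _ _
    have h5 : ζ.re - z.re ≤ ‖ζ - z‖ := by
      simpa using Complex.re_le_norm (ζ - z)
    have h6 := hz.2
    rw [norm_sub_rev] at h4 h6
    have h7 : c * ‖1 - z‖ ≤ c * (‖ζ - 1‖ + ‖ζ - z‖) := by gcongr
    have h8 : c * ‖ζ - z‖ ≤ 1 * ‖ζ - z‖ := by gcongr
    nlinarith

/-- Cauchy's estimate on a disc about `z` of radius proportional to `|1 - z|`, on which `|1 - ζ|` is
comparable to `|1 - z|`. Each derivative costs one power of `|1 - z|`. -/
lemma exists_norm_iteratedDeriv_le {c η b : ℝ} (hc : 0 < c) (hc1 : c ≤ 1) (hη : 0 < η)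
    (hη1 : η ≤ 1) {g : ℂ → ℂ} (hg : AnalyticOnNhd ℂ g (coneDomain c η))
    (hgO : g =O[𝓟 (coneDomain c η)] fun z : ℂ => ‖1 - z‖ ^ b) (j : ℕ) :
    ∃ C : ℝ, 0 ≤ C ∧ ∀ z ∈ coneDomain (c / 2) (η / 2),
      ‖iteratedDeriv j g z‖ ≤ C * ‖1 - z‖ ^ (b - j) := by
  obtain ⟨C, hC0, hC⟩ := hgO.exists_nonneg
  rw [isBigOWith_principal] at hC
  set δ := min (c / 4) (η / 8) with hδ
  have hδ0 : 0 < δ := by positivity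
  have hδ1 : δ ≤ 1 / 4 := (min_le_left _ _).trans (by linarith)
  refine ⟨j.factorial * (C * 2 ^ |b|) / δ ^ j, by positivity, fun z hz => ?_⟩
  have h0 := norm_one_sub_pos hz
  have hsub : Metric.closedBall z (δ * ‖1 - z‖) ⊆ coneDomain c η := fun ζ hζ =>
    mem_coneDomain_of_norm_sub_le hc hc1 hη hη1 hz (by simpa [dist_eq_norm] using hζ)
  have hR : 0 < δ * ‖1 - z‖ := by positivity
  have hd : DiffContOnCl ℂ g (Metric.ball z (δ * ‖1 - z‖)) := by
    apply DifferentiableOn.diffContOnCl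
    rw [closure_ball _ hR.ne']
    exact hg.differentiableOn.mono hsub
  have := Complex.norm_iteratedDeriv_le_of_forall_mem_sphere_norm_le (C := C * 2 ^ |b| * ‖1 - z‖ ^ b)
    j hR hd ?_
  · refine this.trans (le_of_eq ?_)
    rw [Real.rpow_sub h0, Real.rpow_natCast, mul_pow]
    field_simp
  · intro ζ hζ
    have hζ' := hsub (Metric.sphere_subset_closedBall hζ)
    have h1 := norm_one_sub_pos hζ'
    have h2 : ‖ζ - z‖ = δ * ‖1 - z‖ := by simpa [dist_eq_norm] using hζ
    refine (hC ζ hζ').trans ?_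
    rw [Real.norm_of_nonneg (by positivity), mul_assoc]
    gcongr
    have h3 : ‖1 - ζ‖ ≤ ‖1 - z‖ + ‖ζ - z‖ := by
      have : 1 - ζ = (1 - z) - (ζ - z) := by ring
      rw [this]
      exact norm_sub_le _ _
    have h4 : ‖1 - z‖ ≤ ‖1 - ζ‖ + ‖ζ - z‖ := by
      have : 1 - z = (1 - ζ) + (ζ - z) := by ring
      rw [this]
      exact norm_add_le _ _
    exact rpow_le_of_comparable one_le_two h1 h0 (by nlinarith) (by nlinarith)

lemma analyticOnNhd_iteratedDeriv {g : ℂ → ℂ} {D : Set ℂ} (hg : AnalyticOnNhd ℂ g D)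
    (j : ℕ) : AnalyticOnNhd ℂ (iteratedDeriv j g) D := by
  rw [iteratedDeriv_eq_iterate]
  exact hg.iterated_deriv j

/-! ### The model integrals `∫ s^a (ρ + s)^p`. -/

lemma sin_half_comparable_min {θ : ℝ} (h : θ ∈ Set.Ioo 0 (2 * Real.pi)) :
    Real.sin (θ / 2) ≤ 4 * min θ (2 * Real.pi - θ) ∧
      min θ (2 * Real.pi - θ) ≤ 4 * Real.sin (θ / 2) ∧ 0 < min θ (2 * Real.pi - θ) := by
  have hpi := Real.pi_pos
  have hpi4 := Real.pi_le_four
  have h1 : Real.sin (θ / 2) = Real.sin ((2 * Real.pi - θ) / 2) := by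
    rw [← Real.sin_pi_sub]; congr 1; ring
  have key : ∀ t : ℝ, 0 < t → t ≤ Real.pi → t ≤ 4 * Real.sin (t / 2) := by
    intro t ht ht'
    have h2 := Real.mul_le_sin (x := t / 2) (by linarith) (by linarith)
    have : 2 / 4 * (t / 2) ≤ 2 / Real.pi * (t / 2) := by gcongr
    linarith
  have up : ∀ t : ℝ, 0 < t → Real.sin (t / 2) ≤ 4 * t := by
    intro t ht
    have := Real.sin_le (x := t / 2) (by linarith)
    linarith
  rcases le_total θ (2 * Real.pi - θ) with h2 | h2
  · rw [min_eq_left h2]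
    exact ⟨up θ h.1, key θ h.1 (by linarith), h.1⟩
  · rw [min_eq_right h2, h1]
    exact ⟨up _ (by linarith [h.2]), key _ (by linarith [h.2]) (by linarith), by linarith [h.2]⟩

/-- Integrals over `θ` of functions of `sin (θ / 2)` reduce to integrals of functions of `θ`. -/
lemma exists_integral_sin_half_le {a p : ℝ} (ha : -1 < a) :
    ∃ C : ℝ, 0 ≤ C ∧ ∀ ρ : ℝ, 0 < ρ →
      IntegrableOn (fun θ => Real.sin (θ / 2) ^ a * (ρ + Real.sin (θ / 2)) ^ p)
        (Set.Ioo 0 (2 * Real.pi)) ∧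
      ∫ θ in Set.Ioo 0 (2 * Real.pi), Real.sin (θ / 2) ^ a * (ρ + Real.sin (θ / 2)) ^ p ≤
        C * ∫ t in (0 : ℝ)..2 * Real.pi, t ^ a * (ρ + t) ^ p := by
  have h2pi : (0 : ℝ) ≤ 2 * Real.pi := by positivity
  refine ⟨4 ^ |a| * 4 ^ |p| * 2, by positivity, fun ρ hρ => ?_⟩
  set ψ : ℝ → ℝ := fun t => t ^ a * (ρ + t) ^ p with hψ
  have hψi : IntervalIntegrable ψ volume 0 (2 * Real.pi) := by
    refine (intervalIntegral.intervalIntegrable_rpow' ha).mul_continuousOn ?_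
    rw [Set.uIcc_of_le h2pi]
    intro t ht
    refine ContinuousAt.continuousWithinAt ?_
    exact ContinuousAt.rpow_const (by fun_prop) (Or.inl (by linarith [ht.1]))
  have hψr : IntervalIntegrable (fun t => ψ (2 * Real.pi - t)) volume 0 (2 * Real.pi) := by
    simpa using (hψi.comp_sub_left (2 * Real.pi)).symm
  have hsum := hψi.add hψr
  have hint : IntegrableOn (fun θ => 4 ^ |a| * 4 ^ |p| * (ψ θ + ψ (2 * Real.pi - θ)))
      (Set.Ioo 0 (2 * Real.pi)) := by
    rw [intervalIntegrable_iff_integrableOn_Ioo_of_le h2pi] at hsum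
    exact hsum.const_mul _
  have hle : ∀ θ ∈ Set.Ioo 0 (2 * Real.pi),
      Real.sin (θ / 2) ^ a * (ρ + Real.sin (θ / 2)) ^ p ≤
        4 ^ |a| * 4 ^ |p| * (ψ θ + ψ (2 * Real.pi - θ)) := by
    intro θ hθ
    obtain ⟨h1, h2, h3⟩ := sin_half_comparable_min hθ
    have hs := sin_half_pos hθ
    set m := min θ (2 * Real.pi - θ) with hm
    -- `ψ` need not be monotone, so its value at the distance to the nearer endpoint is bounded by
    -- the sum over both endpoints. Reflection makes their integrals equal, whence the factor `2`.
    have h4 : ψ m ≤ ψ θ + ψ (2 * Real.pi - θ) := by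
      have h5 : 0 < θ := hθ.1
      have h6 : 0 < 2 * Real.pi - θ := by linarith [hθ.2]
      have h7 : 0 ≤ ψ θ := by simp only [hψ]; positivity
      have h8 : 0 ≤ ψ (2 * Real.pi - θ) := by simp only [hψ]; positivity
      rcases min_choice θ (2 * Real.pi - θ) with h | h <;> rw [hm, h] <;> linarith
    calc _ ≤ (4 ^ |a| * m ^ a) * (4 ^ |p| * (ρ + m) ^ p) := by
          gcongr
          · exact rpow_le_of_comparable (by norm_num) hs h3 h1 h2
          · exact rpow_le_of_comparable (by norm_num) (by positivity) (by positivity)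
              (by linarith) (by linarith)
      _ = 4 ^ |a| * 4 ^ |p| * ψ m := by simp only [hψ]; ring
      _ ≤ _ := by gcongr
  have hcont : ContinuousOn (fun θ => Real.sin (θ / 2) ^ a * (ρ + Real.sin (θ / 2)) ^ p)
      (Set.Ioo 0 (2 * Real.pi)) := by
    intro θ hθ
    have hs := sin_half_pos hθ
    refine ContinuousAt.continuousWithinAt (ContinuousAt.mul ?_ ?_)
    · exact ContinuousAt.rpow_const (by fun_prop) (Or.inl hs.ne')
    · exact ContinuousAt.rpow_const (by fun_prop) (Or.inl (by positivity))
  have hI : IntegrableOn (fun θ => Real.sin (θ / 2) ^ a * (ρ + Real.sin (θ / 2)) ^ p)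
      (Set.Ioo 0 (2 * Real.pi)) := by
    refine Integrable.mono' hint (hcont.aestronglyMeasurable measurableSet_Ioo) ?_
    refine ae_restrict_of_forall_mem measurableSet_Ioo fun θ hθ => ?_
    have hs := sin_half_pos hθ
    rw [Real.norm_of_nonneg (by positivity)]
    exact hle θ hθ
  refine ⟨hI, (setIntegral_mono_on hI hint measurableSet_Ioo hle).trans (le_of_eq ?_)⟩
  rw [← integral_Ioc_eq_integral_Ioo, ← intervalIntegral.integral_of_le h2pi,
    intervalIntegral.integral_const_mul, intervalIntegral.integral_add hψi hψr,
    intervalIntegral.integral_comp_sub_left]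
  simp only [sub_self, sub_zero]
  ring

lemma integrableOn_sin_half_rpow {a : ℝ} (ha : -1 < a) :
    IntegrableOn (fun θ => Real.sin (θ / 2) ^ a) (Set.Ioo 0 (2 * Real.pi)) := by
  obtain ⟨C, -, hC⟩ := exists_integral_sin_half_le (p := 0) ha
  simpa using (hC 1 one_pos).1

/-- Split at `t = ρ`: since `p ≤ 0`, replace `ρ + t` by `ρ` below and by `t` above. -/
lemma integral_rpow_mul_add_rpow_le {a p ρ T : ℝ} (ha : -1 < a) (hp : p ≤ 0) (hρ : 0 < ρ)
    (hρT : ρ ≤ T) :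
    ∫ t in (0 : ℝ)..T, t ^ a * (ρ + t) ^ p ≤
      ρ ^ (a + p + 1) / (a + 1) + ∫ t in ρ..T, t ^ (a + p) := by
  have hi : ∀ x y : ℝ, 0 ≤ x → 0 ≤ y →
      IntervalIntegrable (fun t : ℝ => t ^ a * (ρ + t) ^ p) volume x y := by
    intro x y hx hy
    refine (intervalIntegral.intervalIntegrable_rpow' ha).mul_continuousOn fun t ht => ?_
    have : 0 ≤ t := (le_min hx hy).trans ht.1
    refine ContinuousAt.continuousWithinAt ?_
    exact ContinuousAt.rpow_const (by fun_prop) (Or.inl (by linarith))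
  rw [← intervalIntegral.integral_add_adjacent_intervals (hi 0 ρ le_rfl hρ.le)
    (hi ρ T hρ.le (hρ.le.trans hρT))]
  refine add_le_add ?_ ?_
  · calc _ ≤ ∫ t in (0 : ℝ)..ρ, t ^ a * ρ ^ p := by
          refine intervalIntegral.integral_mono_on hρ.le (hi 0 ρ le_rfl hρ.le)
            ((intervalIntegral.intervalIntegrable_rpow' ha).mul_const _) fun t ht => ?_
          have h0 := ht.1
          gcongr ?_ * ?_
          exact Real.rpow_le_rpow_of_nonpos hρ (by linarith) hp
      _ = _ := by
          rw [intervalIntegral.integral_mul_const, integral_rpow (Or.inl ha),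
            Real.zero_rpow (by linarith), sub_zero, div_mul_eq_mul_div, ← Real.rpow_add hρ]
          congr 2; ring
  · refine intervalIntegral.integral_mono_on hρT (hi ρ T hρ.le (hρ.le.trans hρT)) ?_ fun t ht => ?_
    · refine intervalIntegral.intervalIntegrable_rpow (Or.inr ?_)
      rw [Set.uIcc_of_le hρT]
      exact fun h => absurd h.1 (not_le.2 hρ)
    · have h0 : 0 < t := hρ.trans_le ht.1
      rw [Real.rpow_add h0]
      gcongr ?_ * ?_
      exact Real.rpow_le_rpow_of_nonpos h0 (by linarith) hp

lemma exists_integral_le_rpow {a p : ℝ} (ha : -1 < a) (hq : a + p + 1 < 0) :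
    ∃ C : ℝ, 0 ≤ C ∧ ∀ ρ : ℝ, 0 < ρ → ρ ≤ 3 →
      ∫ θ in Set.Ioo 0 (2 * Real.pi), Real.sin (θ / 2) ^ a * (ρ + Real.sin (θ / 2)) ^ p ≤
        C * ρ ^ (a + p + 1) := by
  obtain ⟨C, hC0, hC⟩ := exists_integral_sin_half_le (p := p) ha
  have ha1 : 0 < a + 1 := by linarith
  refine ⟨C * ((a + 1)⁻¹ + (-(a + p + 1))⁻¹), ?_, fun ρ hρ hρ3 => (hC ρ hρ).2.trans ?_⟩
  · have : 0 < -(a + p + 1) := by linarith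
    positivity
  rw [mul_assoc]
  gcongr
  have hpi := Real.pi_gt_three
  refine (integral_rpow_mul_add_rpow_le ha (by linarith) hρ (by linarith)).trans ?_
  rw [integral_rpow (Or.inr ⟨by linarith, ?_⟩)]
  · have : 0 ≤ (2 * Real.pi) ^ (a + p + 1) * (-(a + p + 1))⁻¹ := by
      have : 0 < -(a + p + 1) := by linarith
      positivity
    rw [inv_neg] at *
    rw [div_eq_mul_inv, div_eq_mul_inv, sub_mul]
    linarith
  · rw [Set.uIcc_of_le (by linarith)]
    exact fun h => absurd h.1 (not_le.2 hρ)

/-- The constant `5` exceeds `log (2π)` and keeps `5 - log ρ ≥ 3` for `ρ ≤ 3`, so the bounded part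
of the integral can be absorbed too. -/
lemma exists_integral_le_log {a p : ℝ} (ha : -1 < a) (hq : a + p + 1 = 0) :
    ∃ C : ℝ, 0 ≤ C ∧ ∀ ρ : ℝ, 0 < ρ → ρ ≤ 3 →
      ∫ θ in Set.Ioo 0 (2 * Real.pi), Real.sin (θ / 2) ^ a * (ρ + Real.sin (θ / 2)) ^ p ≤
        C * (5 - Real.log ρ) := by
  obtain ⟨C, hC0, hC⟩ := exists_integral_sin_half_le (p := p) ha
  have ha1 : 0 < a + 1 := by linarith
  refine ⟨C * ((a + 1)⁻¹ + 1), by positivity, fun ρ hρ hρ3 => (hC ρ hρ).2.trans ?_⟩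
  rw [mul_assoc]
  gcongr
  have hpi := Real.pi_gt_three
  refine (integral_rpow_mul_add_rpow_le ha (by linarith) hρ (by linarith)).trans ?_
  have h1 : a + p = -1 := by linarith
  have h2 : ∫ t in ρ..2 * Real.pi, t ^ (a + p) = Real.log (2 * Real.pi) - Real.log ρ := by
    simp only [h1, Real.rpow_neg_one]
    rw [integral_inv_of_pos hρ (by linarith), Real.log_div (by positivity) hρ.ne']
  have h3 : Real.log (2 * Real.pi) ≤ 5 := by
    rw [Real.log_le_iff_le_exp (by positivity)]
    have := Real.add_one_le_exp (5 / 2 : ℝ)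
    have h4 : Real.exp 5 = Real.exp (5 / 2) * Real.exp (5 / 2) := by
      rw [← Real.exp_add]; norm_num
    have := Real.pi_le_four
    nlinarith
  have h5 : Real.log ρ ≤ 3 - 1 := (Real.log_le_sub_one_of_pos hρ).trans (by linarith)
  have h6 : (a + 1)⁻¹ * 1 ≤ (a + 1)⁻¹ * (5 - Real.log ρ) := by
    gcongr; linarith
  rw [h2, hq, Real.rpow_zero, one_div]
  linarith

/-! ### The contour integral, its derivatives and their limits at `1`. -/

/-- The integrand of the contour integral for the `j`-th derivative of the Hadamard product. -/
noncomputable def spiralIntegrand (κ : ℝ) (k : ℝ → ℂ) (g : ℂ → ℂ) (j : ℕ) (z : ℂ) (θ : ℝ) : ℂ :=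
  k θ * (spiral κ θ)⁻¹ ^ j * iteratedDeriv j g (z / spiral κ θ)

/-- `∫ k(θ) w⁻ʲ g⁽ʲ⁾(z / w) dθ` along the spiral `w = w(θ)`. -/
noncomputable def spiralIntegral (κ : ℝ) (k : ℝ → ℂ) (g : ℂ → ℂ) (j : ℕ) (z : ℂ) : ℂ :=
  ∫ θ in Set.Ioo 0 (2 * Real.pi), spiralIntegrand κ k g j z θ

/-- The standing assumptions on a contour, a weight and a function. -/
structure SpiralData (κ c η a b : ℝ) (k : ℝ → ℂ) (g : ℂ → ℂ) : Prop where
  kappa_pos : 0 < κ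
  kappa_le : 2 * κ ≤ 1
  kappa_le_c : κ ≤ c / 2
  kappa_le_eta : 4 * κ ≤ η
  c_le : c ≤ 1
  eta_le : η ≤ 1
  lt_a : -1 < a
  continuousOn : ContinuousOn k (Set.Ioo 0 (2 * Real.pi))
  exists_bound : ∃ K : ℝ, 0 ≤ K ∧ ∀ θ ∈ Set.Ioo 0 (2 * Real.pi), ‖k θ‖ ≤ K * Real.sin (θ / 2) ^ a
  analytic : AnalyticOnNhd ℂ g (coneDomain c η)
  isBigO : g =O[𝓟 (coneDomain c η)] fun z : ℂ => ‖1 - z‖ ^ b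

namespace SpiralData

variable {κ c η a b : ℝ} {k : ℝ → ℂ} {g : ℂ → ℂ}

lemma div_mem_half (H : SpiralData κ c η a b k g) {z : ℂ} (hz : z ∈ spiralSet (κ / 2)) {θ : ℝ}
    (hθ : θ ∈ Set.Ioo 0 (2 * Real.pi)) : z / spiral κ θ ∈ coneDomain (c / 2) (η / 2) :=
  div_spiral_mem_coneDomain H.kappa_pos (by linarith [H.kappa_le, H.kappa_pos]) H.kappa_le_c
    (by linarith [H.kappa_le_eta]) hθ hz

lemma div_mem (H : SpiralData κ c η a b k g) {z : ℂ} (hz : z ∈ spiralSet (κ / 2)) {θ : ℝ}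
    (hθ : θ ∈ Set.Ioo 0 (2 * Real.pi)) : z / spiral κ θ ∈ coneDomain c η :=
  coneDomain_mono (by linarith [H.kappa_pos, H.kappa_le_c]) (by linarith [H.kappa_pos, H.kappa_le_eta])
    (H.div_mem_half hz hθ)

lemma exists_norm_integrand_le (H : SpiralData κ c η a b k g) (j : ℕ) :
    ∃ C : ℝ, 0 ≤ C ∧ ∀ z ∈ spiralSet (κ / 2), ∀ θ ∈ Set.Ioo 0 (2 * Real.pi),
      ‖spiralIntegrand κ k g j z θ‖ ≤
        C * (Real.sin (θ / 2) ^ a * (‖1 - z‖ + Real.sin (θ / 2)) ^ (b - j)) := by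
  have hκ := H.kappa_pos
  have hκ1 : κ ≤ 1 := by linarith [H.kappa_le]
  obtain ⟨K, hK0, hK⟩ := H.exists_bound
  obtain ⟨C, hC0, hC⟩ := exists_norm_iteratedDeriv_le (by linarith [H.kappa_le_c]) H.c_le
    (by linarith [H.kappa_le_eta]) H.eta_le H.analytic H.isBigO j
  refine ⟨K * (C * (43 / κ) ^ |b - j|), by positivity, fun z hz θ hθ => ?_⟩
  have hs := sin_half_pos hθ
  have hm := H.div_mem_half hz hθ
  have h1 := hK θ hθ
  have h2 := hC _ hm
  have h3 : ‖(spiral κ θ)⁻¹ ^ j‖ ≤ 1 := by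
    rw [norm_pow, norm_inv]
    exact pow_le_one₀ (by positivity) (inv_le_one_of_one_le₀ (one_le_norm_spiral hκ.le hθ))
  have h4 : ‖1 - z / spiral κ θ‖ ^ (b - j) ≤
      (43 / κ) ^ |b - j| * (‖1 - z‖ + Real.sin (θ / 2)) ^ (b - j) :=
    rpow_le_of_comparable (by rw [le_div_iff₀ hκ]; linarith) (norm_one_sub_pos hm) (by positivity)
      (norm_one_sub_div_spiral_le hκ hκ1 hθ) (add_sin_le_norm_one_sub_div_spiral hκ hκ1 hθ hz)
  rw [spiralIntegrand, norm_mul, norm_mul]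
  calc _ ≤ (K * Real.sin (θ / 2) ^ a) * 1 *
        (C * ((43 / κ) ^ |b - j| * (‖1 - z‖ + Real.sin (θ / 2)) ^ (b - j))) := by
        gcongr
        exact h2.trans (by gcongr)
    _ = _ := by ring

lemma continuousOn_integrand (H : SpiralData κ c η a b k g) (j : ℕ) {z : ℂ}
    (hz : z ∈ spiralSet (κ / 2)) :
    ContinuousOn (spiralIntegrand κ k g j z) (Set.Ioo 0 (2 * Real.pi)) := by
  have hi : ContinuousOn (fun θ => (spiral κ θ)⁻¹) (Set.Ioo 0 (2 * Real.pi)) :=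
    (continuous_spiral κ).continuousOn.inv₀ fun θ _ => spiral_ne_zero κ θ
  refine (H.continuousOn.mul (hi.pow j)).mul ?_
  refine (analyticOnNhd_iteratedDeriv H.analytic j).continuousOn.comp ?_ fun θ hθ => H.div_mem hz hθ
  simp only [div_eq_mul_inv]
  exact continuousOn_const.mul hi

lemma aestronglyMeasurable_integrand (H : SpiralData κ c η a b k g) (j : ℕ) {z : ℂ}
    (hz : z ∈ spiralSet (κ / 2)) :
    AEStronglyMeasurable (spiralIntegrand κ k g j z)
      (volume.restrict (Set.Ioo 0 (2 * Real.pi))) :=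
  (H.continuousOn_integrand j hz).aestronglyMeasurable measurableSet_Ioo

lemma hasDerivAt_integrand (H : SpiralData κ c η a b k g) (j : ℕ) {z : ℂ}
    (hz : z ∈ spiralSet (κ / 2)) {θ : ℝ} (hθ : θ ∈ Set.Ioo 0 (2 * Real.pi)) :
    HasDerivAt (fun z => spiralIntegrand κ k g j z θ) (spiralIntegrand κ k g (j + 1) z θ) z := by
  have h1 := ((analyticOnNhd_iteratedDeriv H.analytic j) _
    (H.div_mem hz hθ)).differentiableAt.hasDerivAt
  rw [← iteratedDeriv_succ] at h1
  have h2 : HasDerivAt (fun z : ℂ => z / spiral κ θ) (1 / spiral κ θ) z :=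
    (hasDerivAt_id z).div_const _
  refine ((h1.comp z h2).const_mul (k θ * (spiral κ θ)⁻¹ ^ j)).congr_deriv ?_
  rw [spiralIntegrand]
  ring

lemma integrable_integrand (H : SpiralData κ c η a b k g) (j : ℕ) {z : ℂ}
    (hz : z ∈ spiralSet (κ / 2)) (h1 : z ≠ 1) :
    IntegrableOn (spiralIntegrand κ k g j z) (Set.Ioo 0 (2 * Real.pi)) := by
  obtain ⟨C, -, hC⟩ := H.exists_norm_integrand_le j
  obtain ⟨C', -, hC'⟩ := exists_integral_sin_half_le (p := b - j) H.lt_a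
  refine Integrable.mono' (((hC' ‖1 - z‖ (norm_pos_iff.2 (sub_ne_zero.2 h1.symm))).1).const_mul C)
    (H.aestronglyMeasurable_integrand j hz) ?_
  exact ae_restrict_of_forall_mem measurableSet_Ioo fun θ hθ => hC z hz θ hθ

lemma norm_spiralIntegral_le (H : SpiralData κ c η a b k g) (j : ℕ) :
    ∃ C : ℝ, 0 ≤ C ∧ ∀ z ∈ spiralSet (κ / 2), z ≠ 1 →
      ‖spiralIntegral κ k g j z‖ ≤ C * ∫ θ in Set.Ioo 0 (2 * Real.pi),
        Real.sin (θ / 2) ^ a * (‖1 - z‖ + Real.sin (θ / 2)) ^ (b - j) := by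
  obtain ⟨C, hC0, hC⟩ := H.exists_norm_integrand_le j
  obtain ⟨C', -, hC'⟩ := exists_integral_sin_half_le (p := b - j) H.lt_a
  refine ⟨C, hC0, fun z hz h1 => ?_⟩
  rw [← integral_const_mul]
  refine norm_integral_le_of_norm_le
    (((hC' ‖1 - z‖ (norm_pos_iff.2 (sub_ne_zero.2 h1.symm))).1).const_mul C) ?_
  exact ae_restrict_of_forall_mem measurableSet_Ioo fun θ hθ => hC z hz θ hθ

lemma hasDerivAt_spiralIntegral (H : SpiralData κ c η a b k g) (j : ℕ) {D : Set ℂ}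
    (hD : IsOpen D) (hDs : D ⊆ spiralSet (κ / 2)) (h1 : (1 : ℂ) ∉ D) {z : ℂ} (hz : z ∈ D) :
    HasDerivAt (spiralIntegral κ k g j) (spiralIntegral κ k g (j + 1) z) z := by
  obtain ⟨C, hC0, hC⟩ := H.exists_norm_integrand_le (j + 1)
  have hz1 : z ≠ 1 := fun h => h1 (h ▸ hz)
  set ρ := ‖1 - z‖ with hρ
  have hρ0 : 0 < ρ := norm_pos_iff.2 (sub_ne_zero.2 hz1.symm)
  -- On the ball of radius `ρ / 2` about `z`, `|1 - x| + s` lies between `ρ / 2` and `3ρ / 2 + 1`.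
  -- It is thus comparable to `1` with constant `K`, and the integrable `s^a` dominates.
  set K : ℝ := 2 * ρ + 1 + 2 / ρ with hK
  have hK1 : 1 ≤ K := by
    have : 0 < 2 / ρ := by positivity
    linarith
  set e : ℝ := b - (j + 1 : ℕ) with he
  refine (hasDerivAt_integral_of_dominated_loc_of_deriv_le (𝕜 := ℂ)
    (F := fun z θ => spiralIntegrand κ k g j z θ)
    (F' := fun z θ => spiralIntegrand κ k g (j + 1) z θ)
    (bound := fun θ => C * K ^ |e| * Real.sin (θ / 2) ^ a)
    (Filter.inter_mem (hD.mem_nhds hz) (Metric.ball_mem_nhds z (half_pos hρ0)))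
    ?_ (H.integrable_integrand j (hDs hz) hz1)
    (H.aestronglyMeasurable_integrand (j + 1) (hDs hz)) ?_ ?_ ?_).2
  · filter_upwards [hD.mem_nhds hz] with x hx
    exact H.aestronglyMeasurable_integrand j (hDs hx)
  · refine ae_restrict_of_forall_mem measurableSet_Ioo fun θ hθ x hx => ?_
    have hs := sin_half_pos hθ
    have hs1 := Real.sin_le_one (θ / 2)
    have hx2 : ‖x - z‖ < ρ / 2 := by simpa [dist_eq_norm] using hx.2
    have h3 : ‖1 - x‖ ≤ ρ + ‖x - z‖ := by
      have : 1 - x = (1 - z) - (x - z) := by ring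
      rw [this]
      exact norm_sub_le _ _
    have h4 : ρ ≤ ‖1 - x‖ + ‖x - z‖ := by
      have : 1 - z = (1 - x) + (x - z) := by ring
      rw [hρ, this]
      exact norm_add_le _ _
    have h5 : (‖1 - x‖ + Real.sin (θ / 2)) ^ e ≤ K ^ |e| * 1 ^ e := by
      have h6 : 0 < 2 / ρ := by positivity
      refine rpow_le_of_comparable hK1 (by linarith) one_pos (by linarith) ?_
      calc (1 : ℝ) = 2 / ρ * (ρ / 2) := by field_simp
        _ ≤ K * (‖1 - x‖ + Real.sin (θ / 2)) := by gcongr <;> linarith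
    rw [Real.one_rpow, mul_one] at h5
    calc _ ≤ C * (Real.sin (θ / 2) ^ a * (‖1 - x‖ + Real.sin (θ / 2)) ^ e) := hC x (hDs hx.1) θ hθ
      _ ≤ C * (Real.sin (θ / 2) ^ a * K ^ |e|) := by gcongr
      _ = _ := by ring
  · exact (integrableOn_sin_half_rpow H.lt_a).const_mul _
  · exact ae_restrict_of_forall_mem measurableSet_Ioo fun θ hθ x hx =>
      H.hasDerivAt_integrand j (hDs hx.1) hθ

lemma iteratedDeriv_spiralIntegral (H : SpiralData κ c η a b k g) {D : Set ℂ}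
    (hD : IsOpen D) (hDs : D ⊆ spiralSet (κ / 2)) (h1 : (1 : ℂ) ∉ D) (j : ℕ) :
    ∀ z ∈ D, iteratedDeriv j (spiralIntegral κ k g 0) z = spiralIntegral κ k g j z := by
  induction j with
  | zero => simp
  | succ j ih =>
    intro z hz
    rw [iteratedDeriv_succ]
    have : iteratedDeriv j (spiralIntegral κ k g 0) =ᶠ[𝓝 z] spiralIntegral κ k g j := by
      filter_upwards [hD.mem_nhds hz] with x hx using ih x hx
    rw [this.deriv_eq]
    exact (H.hasDerivAt_spiralIntegral j hD hDs h1 hz).deriv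

/-- Dominated convergence up to `z = 1`. The worst majorant is `s^(a + b - j)`, integrable exactly
because `j < a + b + 1`. The limiting integrand makes sense since `1 / w` lies in the domain of `g`.
-/
lemma tendsto_spiralIntegral (H : SpiralData κ c η a b k g) {D : Set ℂ}
    (hDs : D ⊆ spiralSet (κ / 2)) {j : ℕ} (hj : (j : ℝ) < a + b + 1) :
    Tendsto (spiralIntegral κ k g j) (𝓝[D] 1) (𝓝 (spiralIntegral κ k g j 1)) := by
  obtain ⟨C, hC0, hC⟩ := H.exists_norm_integrand_le j
  set e : ℝ := b - j with he
  refine tendsto_integral_filter_of_dominated_convergence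
    (fun θ => C * (Real.sin (θ / 2) ^ a * 2 ^ |e| + Real.sin (θ / 2) ^ (a + e))) ?_ ?_ ?_ ?_
  · filter_upwards [self_mem_nhdsWithin] with z hz
    exact H.aestronglyMeasurable_integrand j (hDs hz)
  · filter_upwards [self_mem_nhdsWithin,
      mem_nhdsWithin_of_mem_nhds (Metric.ball_mem_nhds (1 : ℂ) one_pos)] with z hz hz1
    have hz2 : ‖1 - z‖ < 1 := by rw [norm_sub_rev]; simpa [dist_eq_norm] using hz1
    refine ae_restrict_of_forall_mem measurableSet_Ioo fun θ hθ => ?_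
    have hs := sin_half_pos hθ
    have hs1 := Real.sin_le_one (θ / 2)
    have hn := norm_nonneg (1 - z)
    refine (hC z (hDs hz) θ hθ).trans ?_
    rw [Real.rpow_add hs, ← mul_add]
    gcongr
    rcases le_or_gt 0 e with h | h
    · have h2 : (‖1 - z‖ + Real.sin (θ / 2)) ^ e ≤ 2 ^ |e| := by
        rw [abs_of_nonneg h]
        exact Real.rpow_le_rpow (by positivity) (by linarith) h
      have : 0 ≤ Real.sin (θ / 2) ^ e := by positivity
      linarith
    · have h2 : (‖1 - z‖ + Real.sin (θ / 2)) ^ e ≤ Real.sin (θ / 2) ^ e :=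
        Real.rpow_le_rpow_of_nonpos hs (by linarith) h.le
      have : (0 : ℝ) ≤ 2 ^ |e| := by positivity
      linarith
  · exact (((integrableOn_sin_half_rpow H.lt_a).mul_const _).add
      (integrableOn_sin_half_rpow (by rw [he]; linarith))).const_mul _
  · refine ae_restrict_of_forall_mem measurableSet_Ioo fun θ hθ => ?_
    exact ((H.hasDerivAt_integrand j (one_mem_spiralSet _) hθ).continuousAt.tendsto).mono_left
      nhdsWithin_le_nhds

end SpiralData

/-! ### From a bound on a high derivative to a Taylor remainder. -/

/-- A nonnegative function on `(0, 3]` that grows at `0` more slowly than some `ρ ^ (-θ)`, `θ < 1`. -/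
structure SlowGrowth (B : ℝ → ℝ) (θ : ℝ) : Prop where
  lt_one : θ < 1
  nonneg : ∀ x, 0 < x → x ≤ 3 → 0 ≤ B x
  -- Equivalent to `x^θ B(x)` being nondecreasing; with `θ < 1` this yields `∫₀ˣ B ≤ x B(x) / (1 -
  -- θ)`.
  deriv_le : ∀ x, 0 < x → x ≤ 3 → DifferentiableAt ℝ B x ∧ -(x * deriv B x) ≤ θ * B x

lemma slowGrowth_rpow {q : ℝ} (hq : -1 < q) : SlowGrowth (fun x => x ^ q) (-q) where
  lt_one := by linarith
  nonneg x hx _ := by positivity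
  deriv_le x hx _ := by
    have h := Real.hasDerivAt_rpow_const (x := x) (p := q) (Or.inl hx.ne')
    refine ⟨h.differentiableAt, le_of_eq ?_⟩
    rw [h.deriv, Real.rpow_sub hx, Real.rpow_one]
    field_simp

lemma log_le_two {x : ℝ} (hx : 0 < x) (hx3 : x ≤ 3) : Real.log x ≤ 2 :=
  (Real.log_le_sub_one_of_pos hx).trans (by linarith)

lemma slowGrowth_log : SlowGrowth (fun x => 5 - Real.log x) (1 / 2) where
  lt_one := by norm_num
  nonneg x hx hx3 := by linarith [log_le_two hx hx3]
  deriv_le x hx hx3 := by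
    have h := (Real.hasDerivAt_log hx.ne').const_sub 5
    refine ⟨h.differentiableAt, ?_⟩
    rw [h.deriv, mul_neg, mul_inv_cancel₀ hx.ne']
    linarith [log_le_two hx hx3]

lemma norm_one_sub_le_three {c η : ℝ} (hη : η ≤ 1) {z : ℂ} (hz : z ∈ coneDomain c η) :
    ‖1 - z‖ ≤ 3 := by
  refine (norm_sub_le _ _).trans ?_
  rw [norm_one]
  linarith [hz.1]

/-- Integration along the segments that end at `1`. -/
lemma norm_le_of_norm_deriv_le {c η θ C : ℝ} {B : ℝ → ℝ} (hη : 0 < η) (hη1 : η ≤ 1)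
    (hB : SlowGrowth B θ) (n : ℕ) {ψ ψ' : ℂ → ℂ}
    (hψ : ∀ z ∈ coneDomain c η, HasDerivAt ψ (ψ' z) z) (hC : 0 ≤ C)
    (hψ' : ∀ z ∈ coneDomain c η, ‖ψ' z‖ ≤ C * (‖1 - z‖ ^ n * B ‖1 - z‖))
    (hlim : Tendsto ψ (𝓝[coneDomain c η] 1) (𝓝 0)) {z : ℂ} (hz : z ∈ coneDomain c η) :
    ‖ψ z‖ ≤ C / (1 - θ) * (‖1 - z‖ ^ (n + 1) * B ‖1 - z‖) := by
  have hθ : 0 < 1 - θ := by linarith [hB.lt_one]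
  have hρ0 := norm_one_sub_pos hz
  have hρ3 := norm_one_sub_le_three hη1 hz
  set ρ := ‖1 - z‖ with hρ
  set γ : ℝ → ℂ := fun t => 1 + (t : ℂ) * (z - 1) with hγ
  have hγmem : ∀ t : ℝ, 0 < t → t ≤ 1 → γ t ∈ coneDomain c η := fun t h0 h1 =>
    segment_mem_coneDomain hη hz h0 h1
  have hγn : ∀ t : ℝ, 0 < t → ‖1 - γ t‖ = t * ρ := by
    intro t ht
    have : 1 - γ t = (t : ℂ) * (1 - z) := by simp only [hγ]; ring
    rw [this, norm_mul, Complex.norm_of_nonneg ht.le]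
  have hγd : ∀ t : ℝ, HasDerivAt γ (z - 1) t := by
    intro t
    exact (((Complex.ofRealCLM.hasDerivAt (x := t)).mul_const (z - 1)).const_add 1).congr_deriv
      (by simp)
  have key : ∀ ε : ℝ, 0 < ε → ε ≤ 1 →
      ‖ψ z‖ ≤ C / (1 - θ) * (ρ ^ (n + 1) * B ρ) + ‖ψ (γ ε)‖ := by
    intro ε hε hε1
    -- The majorant includes the starting value `‖ψ (γ ε)‖`, so nothing is evaluated at `1`. This
    -- term vanishes as `ε → 0` by `hlim`.
    set β : ℝ → ℝ := fun t => C / (1 - θ) * ((t * ρ) ^ (n + 1) * B (t * ρ)) + ‖ψ (γ ε)‖ with hβ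
    have hx : ∀ t ∈ Set.Icc ε 1, 0 < t * ρ ∧ t * ρ ≤ 3 := by
      intro t ht
      have : 0 < t := hε.trans_le ht.1
      exact ⟨by positivity, by nlinarith [ht.2]⟩
    have hβd : ∀ t ∈ Set.Icc ε 1, HasDerivAt β (C / (1 - θ) *
        ((n + 1 : ℕ) * (t * ρ) ^ n * ρ * B (t * ρ) + (t * ρ) ^ (n + 1) * (deriv B (t * ρ) * ρ))) t := by
      intro t ht
      obtain ⟨h1, h2⟩ := hx t ht
      have h3 : HasDerivAt (fun t : ℝ => t * ρ) ρ t := by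
        simpa using (hasDerivAt_id t).mul_const ρ
      have h4 := (hB.deriv_le _ h1 h2).1.hasDerivAt.comp t h3
      have h5 := h3.pow (n + 1)
      exact (((h5.mul h4).const_mul (C / (1 - θ))).add_const ‖ψ (γ ε)‖).congr_deriv (by simp)
    have hfd : ∀ t ∈ Set.Icc ε 1, HasDerivAt (fun t => ψ (γ t)) (ψ' (γ t) * (z - 1)) t := by
      intro t ht
      exact (hψ _ (hγmem t (hε.trans_le ht.1) ht.2)).comp_of_eq t (hγd t) rfl
    have := image_norm_le_of_norm_deriv_right_le_deriv_boundary' (a := ε) (b := 1)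
      (f := fun t => ψ (γ t)) (B := β)
      (fun t ht => (hfd t ht).continuousAt.continuousWithinAt)
      (fun t ht => (hfd t ⟨ht.1, ht.2.le⟩).hasDerivWithinAt) ?_
      (fun t ht => (hβd t ht).continuousAt.continuousWithinAt)
      (fun t ht => (hβd t ⟨ht.1, ht.2.le⟩).hasDerivWithinAt) ?_ (x := 1) ⟨hε1, le_rfl⟩
    · simpa [hβ, hγ] using this
    · simp only [hβ]
      obtain ⟨h1, h2⟩ := hx ε ⟨le_rfl, hε1⟩
      have := hB.nonneg _ h1 h2
      have : 0 ≤ C / (1 - θ) * ((ε * ρ) ^ (n + 1) * B (ε * ρ)) := by positivity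
      linarith
    · intro t ht
      have ht0 : 0 < t := hε.trans_le ht.1
      obtain ⟨h1, h2⟩ := hx t ⟨ht.1, ht.2.le⟩
      have h3 := hψ' _ (hγmem t ht0 ht.2.le)
      rw [hγn t ht0] at h3
      have h4 := (hB.deriv_le _ h1 h2).2
      have h5 := hB.nonneg _ h1 h2
      rw [norm_mul, norm_sub_rev z 1, ← hρ]
      set x := t * ρ
      -- The derivative of `x^(n+1) B(x)` loses at most `θ x^n B(x)` through `B'`, and the factor `n
      -- + 1 ≥ 1` covers this.
      have h6 : (1 - θ) * (x ^ n * B x) ≤ (n + 1 : ℕ) * x ^ n * B x + x ^ (n + 1) * deriv B x := by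
        have h7 : x ^ n * (-(x * deriv B x)) ≤ x ^ n * (θ * B x) := by gcongr
        have h8 : 0 ≤ (n : ℝ) * (x ^ n * B x) := by positivity
        push_cast
        rw [pow_succ]
        linarith
      calc _ ≤ C * (x ^ n * B x) * ρ := by gcongr
        _ = C / (1 - θ) * ρ * ((1 - θ) * (x ^ n * B x)) := by field_simp
        _ ≤ C / (1 - θ) * ρ * ((n + 1 : ℕ) * x ^ n * B x + x ^ (n + 1) * deriv B x) := by
          gcongr
        _ = _ := by ring
  have hto : Tendsto γ (𝓝[>] 0) (𝓝[coneDomain c η] 1) := by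
    refine tendsto_nhdsWithin_of_tendsto_nhds_of_eventually_within _ ?_ ?_
    · have := (hγd 0).continuousAt.tendsto.mono_left (nhdsWithin_le_nhds (s := Set.Ioi 0))
      simpa [hγ] using this
    · filter_upwards [Ioc_mem_nhdsGT one_pos] with t ht using hγmem t ht.1 ht.2
  have hto2 : Tendsto (fun ε => C / (1 - θ) * (ρ ^ (n + 1) * B ρ) + ‖ψ (γ ε)‖) (𝓝[>] 0)
      (𝓝 (C / (1 - θ) * (ρ ^ (n + 1) * B ρ) + 0)) := by
    have := (hlim.comp hto).norm
    rw [norm_zero] at this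
    exact this.const_add _
  rw [add_zero] at hto2
  refine ge_of_tendsto hto2 ?_
  filter_upwards [Ioc_mem_nhdsGT one_pos] with t ht using key t ht.1 ht.2

lemma taylorPolyAtOne_succ (d : ℕ → ℂ) (m : ℕ) (z : ℂ) : taylorPolyAtOne d (m + 1) z =
    (∑ j ∈ Finset.range m,
      (-1) ^ (j + 1) / ((j + 1).factorial : ℂ) * d (j + 1) * (1 - z) ^ (j + 1)) + d 0 := by
  rw [taylorPolyAtOne, Finset.sum_range_succ']
  simp

lemma hasDerivAt_taylorPolyAtOne (d : ℕ → ℂ) (m : ℕ) (z : ℂ) :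
    HasDerivAt (taylorPolyAtOne d (m + 1)) (taylorPolyAtOne (fun j => d (j + 1)) m z) z := by
  have h : taylorPolyAtOne d (m + 1) = fun z => (∑ j ∈ Finset.range m,
      (-1) ^ (j + 1) / ((j + 1).factorial : ℂ) * d (j + 1) * (1 - z) ^ (j + 1)) + d 0 :=
    funext (taylorPolyAtOne_succ d m)
  rw [h]
  refine HasDerivAt.add_const _ (HasDerivAt.fun_sum fun j _ => ?_)
  have h1 : HasDerivAt (fun z : ℂ => 1 - z) (-1) z := (hasDerivAt_id z).const_sub 1
  refine ((h1.pow (j + 1)).const_mul _).congr_deriv ?_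
  have h2 : ((j + 1).factorial : ℂ) = (j + 1) * j.factorial := by
    rw [Nat.factorial_succ]; push_cast; ring
  have h3 : (j.factorial : ℂ) ≠ 0 := by exact_mod_cast j.factorial_ne_zero
  have h4 : (j + 1 : ℂ) ≠ 0 := by exact_mod_cast j.succ_ne_zero
  rw [h2]
  push_cast
  field_simp
  ring

/-- Induction on the shifted sequence `H (· + 1)`: differentiating the Taylor polynomial shifts `d`,
and the constant term `d 0` makes the difference tend to `0` at `1`, so one integration along
segments gains one power of `|1 - z|`. -/
lemma exists_norm_sub_taylorPolyAtOne_le {c η θ : ℝ} {B : ℝ → ℝ} (hη : 0 < η) (hη1 : η ≤ 1)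
    (hB : SlowGrowth B θ) (M : ℕ) : ∀ (H : ℕ → ℂ → ℂ) (d : ℕ → ℂ),
    (∀ j, ∀ z ∈ coneDomain c η, HasDerivAt (H j) (H (j + 1) z) z) →
    (∀ j < M, Tendsto (H j) (𝓝[coneDomain c η] 1) (𝓝 (d j))) →
    (∃ C : ℝ, 0 ≤ C ∧ ∀ z ∈ coneDomain c η, ‖H M z‖ ≤ C * B ‖1 - z‖) →
    ∃ C : ℝ, 0 ≤ C ∧ ∀ z ∈ coneDomain c η,
      ‖H 0 z - taylorPolyAtOne d M z‖ ≤ C * (‖1 - z‖ ^ M * B ‖1 - z‖) := by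
  induction M with
  | zero =>
    rintro H d - - ⟨C, hC0, hC⟩
    exact ⟨C, hC0, fun z hz => by simpa [taylorPolyAtOne] using hC z hz⟩
  | succ M ih =>
    intro H d hH hd hC
    obtain ⟨C, hC0, hC⟩ := ih (fun j => H (j + 1)) (fun j => d (j + 1)) (fun j => hH (j + 1))
      (fun j hj => hd (j + 1) (by omega)) hC
    have hθ : 0 < 1 - θ := by linarith [hB.lt_one]
    refine ⟨C / (1 - θ), by positivity, fun z hz => ?_⟩
    refine norm_le_of_norm_deriv_le hη hη1 hB M
      (ψ := fun z => H 0 z - taylorPolyAtOne d (M + 1) z)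
      (ψ' := fun z => H 1 z - taylorPolyAtOne (fun j => d (j + 1)) M z)
      (fun z hz => (hH 0 z hz).sub (hasDerivAt_taylorPolyAtOne d M z)) hC0 hC ?_ hz
    have h1 := (hasDerivAt_taylorPolyAtOne d M 1).continuousAt.tendsto.mono_left
      (nhdsWithin_le_nhds (s := coneDomain c η))
    have h2 : taylorPolyAtOne d (M + 1) 1 = d 0 := by simp [taylorPolyAtOne_succ]
    rw [h2] at h1
    simpa using (hd 0 (by omega)).sub h1

/-! ### Cauchy's coefficient formula on the contour through `1`. -/

/-- A homotopy from a circle (`s = 0`) to the contour `spiral κ` (`s = 1`), in logarithmic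
coordinates. -/
noncomputable def logHomotopy (κ : ℝ) (x : ℝ × ℝ) : ℂ :=
  (x.1 - 1 + x.1 * κ * Real.sin (x.2 / 2) : ℝ) + x.2 * Complex.I

lemma logHomotopy_re (κ : ℝ) (x : ℝ × ℝ) :
    (logHomotopy κ x).re = x.1 - 1 + x.1 * κ * Real.sin (x.2 / 2) := by
  simp only [logHomotopy, Complex.ofReal_re, Complex.I_re, mul_zero, Complex.add_re, Complex.mul_re,
    Complex.ofReal_im, Complex.I_im, mul_one, sub_zero, add_zero]

lemma logHomotopy_im (κ : ℝ) (x : ℝ × ℝ) : (logHomotopy κ x).im = x.2 := by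
  simp only [logHomotopy, Complex.add_im, Complex.ofReal_im, Complex.mul_im, Complex.ofReal_re,
    Complex.I_im, mul_one, Complex.I_re, mul_zero, add_zero, zero_add]

lemma exp_logHomotopy_mem {κ c η s θ : ℝ} (h0 : 0 < κ) (h1 : κ ≤ 1) (hc : κ ≤ c)
    (hη : 2 * κ ≤ η) (hs1 : s < 1) (hθ : θ ∈ Set.Icc 0 (2 * Real.pi)) :
    Complex.exp (logHomotopy κ (s, θ)) ∈ coneDomain c η := by
  refine exp_mem_coneDomain h0 h1 hc hη ?_
  have : 0 ≤ Real.sin (θ / 2) :=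
    Real.sin_nonneg_of_nonneg_of_le_pi (by linarith [hθ.1]) (by linarith [hθ.2])
  rw [logHomotopy_re, logHomotopy_im, abs_of_nonneg this]
  have : 0 ≤ κ * Real.sin (θ / 2) := by positivity
  nlinarith

lemma differentiable_logHomotopy (κ : ℝ) : Differentiable ℝ (logHomotopy κ) := by
  unfold logHomotopy
  refine Differentiable.add ?_ ?_
  · exact Complex.ofRealCLM.differentiable.comp
      (f := fun x : ℝ × ℝ => x.1 - 1 + x.1 * κ * Real.sin (x.2 / 2)) (by fun_prop)
  · exact (Complex.ofRealCLM.differentiable.comp (f := fun x : ℝ × ℝ => x.2) (by fun_prop)).mul_const _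

lemma hasDerivAt_logHomotopy_fst (κ s θ : ℝ) : HasDerivAt (fun s => logHomotopy κ (s, θ))
    ((1 + κ * Real.sin (θ / 2) : ℝ) : ℂ) s := by
  change HasDerivAt (fun s : ℝ => ((s - 1 + s * κ * Real.sin (θ / 2) : ℝ) : ℂ) + θ * Complex.I) _ _
  refine HasDerivAt.add_const _ (HasDerivAt.ofReal_comp ?_)
  refine (((hasDerivAt_id s).sub_const 1).add
    (((hasDerivAt_id s).mul_const κ).mul_const (Real.sin (θ / 2)))).congr_deriv (by ring)

lemma hasDerivAt_sin_half (θ : ℝ) :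
    HasDerivAt (fun θ => Real.sin (θ / 2)) (Real.cos (θ / 2) / 2) θ := by
  refine ((hasDerivAt_id θ).div_const 2).sin.congr_deriv ?_
  simp only [id]
  ring

lemma hasDerivAt_logHomotopy_snd (κ s θ : ℝ) : HasDerivAt (fun θ => logHomotopy κ (s, θ))
    ((s * κ * Real.cos (θ / 2) / 2 : ℝ) + Complex.I : ℂ) θ := by
  change HasDerivAt (fun θ : ℝ => ((s - 1 + s * κ * Real.sin (θ / 2) : ℝ) : ℂ) + θ * Complex.I) _ _
  refine HasDerivAt.add (HasDerivAt.ofReal_comp ?_) ?_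
  · exact (((hasDerivAt_sin_half θ).const_mul (s * κ)).const_add _).congr_deriv (by ring)
  · simpa using (HasDerivAt.ofReal_comp (hasDerivAt_id θ)).mul_const Complex.I

/-- Homotopy invariance of the integral of a `2πi`-periodic holomorphic function along the curves
`logHomotopy κ (s, ·)`. -/
lemma integral_logHomotopy_eq {κ s₁ : ℝ} (hs₁ : 0 ≤ s₁) {Φ : ℂ → ℂ}
    (hper : ∀ u, Φ (u + 2 * Real.pi * Complex.I) = Φ u)
    (hd : ∀ s ∈ Set.Icc 0 s₁, ∀ θ ∈ Set.Icc 0 (2 * Real.pi),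
      DifferentiableAt ℂ Φ (logHomotopy κ (s, θ))) :
    ∫ θ in (0 : ℝ)..2 * Real.pi,
        Φ (logHomotopy κ (s₁, θ)) * ((s₁ * κ * Real.cos (θ / 2) / 2 : ℝ) + Complex.I) =
      ∫ θ in (0 : ℝ)..2 * Real.pi,
        Φ (logHomotopy κ (0, θ)) * ((0 * κ * Real.cos (θ / 2) / 2 : ℝ) + Complex.I) := by
  have h2pi : (0 : ℝ) ≤ 2 * Real.pi := by positivity
  set F : ℝ × ℝ → ℂ := fun x =>
    Φ (logHomotopy κ x) * ((x.1 * κ * Real.cos (x.2 / 2) / 2 : ℝ) + Complex.I) with hF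
  set G : ℝ × ℝ → ℂ := fun x =>
    -(Φ (logHomotopy κ x) * ((1 + κ * Real.sin (x.2 / 2) : ℝ) : ℂ)) with hG
  have hΦ : ∀ x ∈ Set.Icc 0 s₁ ×ˢ Set.Icc 0 (2 * Real.pi),
      DifferentiableAt ℝ (fun x => Φ (logHomotopy κ x)) x := fun x hx =>
    ((hd x.1 hx.1 x.2 hx.2).restrictScalars ℝ).comp x (differentiable_logHomotopy κ x)
  have hFd : ∀ x ∈ Set.Icc 0 s₁ ×ˢ Set.Icc 0 (2 * Real.pi), DifferentiableAt ℝ F x := by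
    intro x hx
    refine (hΦ x hx).mul (DifferentiableAt.add_const _ ?_)
    exact Complex.ofRealCLM.differentiableAt.comp x
      (f := fun x : ℝ × ℝ => x.1 * κ * Real.cos (x.2 / 2) / 2) (by fun_prop)
  have hGd : ∀ x ∈ Set.Icc 0 s₁ ×ˢ Set.Icc 0 (2 * Real.pi), DifferentiableAt ℝ G x := by
    intro x hx
    refine ((hΦ x hx).mul ?_).neg
    exact Complex.ofRealCLM.differentiableAt.comp x
      (f := fun x : ℝ × ℝ => 1 + κ * Real.sin (x.2 / 2)) (by fun_prop)
  -- The form `Φ(u) du` pulls back to a closed form: the terms in `Φ'` cancel, as do the mixed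
  -- second derivatives of `logHomotopy`.
  have hzero : ∀ x ∈ Set.Icc 0 s₁ ×ˢ Set.Icc 0 (2 * Real.pi),
      fderiv ℝ F x (1, 0) + fderiv ℝ G x (0, 1) = 0 := by
    rintro ⟨s, θ⟩ hx
    have hD := (hd s hx.1 θ hx.2).hasDerivAt
    set D := deriv Φ (logHomotopy κ (s, θ))
    have e1 : HasDerivAt (fun s => F (s, θ)) (fderiv ℝ F (s, θ) (1, 0)) s :=
      (hFd (s, θ) hx).hasFDerivAt.comp_hasDerivAt s (f := fun s : ℝ => (s, θ))
        ((hasDerivAt_id' s).prodMk (hasDerivAt_const s θ))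
    have e2 : HasDerivAt (fun θ => G (s, θ)) (fderiv ℝ G (s, θ) (0, 1)) θ :=
      (hGd (s, θ) hx).hasFDerivAt.comp_hasDerivAt θ (f := fun θ : ℝ => (s, θ))
        ((hasDerivAt_const θ s).prodMk (hasDerivAt_id' θ))
    have e3 := (hD.comp s (hasDerivAt_logHomotopy_fst κ s θ)).mul
      ((HasDerivAt.ofReal_comp ((((hasDerivAt_id s).mul_const κ).mul_const
        (Real.cos (θ / 2))).div_const 2)).add_const Complex.I)
    have e4 := ((hD.comp θ (hasDerivAt_logHomotopy_snd κ s θ)).mul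
      (HasDerivAt.ofReal_comp (((hasDerivAt_sin_half θ).const_mul κ).const_add 1))).neg
    rw [e1.unique e3, e2.unique e4]
    simp only [Function.comp, id]
    push_cast
    ring
  have hdiv := integral2_divergence_prod_of_hasFDerivAt F G (fderiv ℝ F) (fderiv ℝ G)
    0 0 s₁ (2 * Real.pi)
    (by
      rw [Set.uIcc_of_le hs₁, Set.uIcc_of_le h2pi]
      exact fun x hx => (hFd x hx).continuousAt.continuousWithinAt)
    (by
      rw [Set.uIcc_of_le hs₁, Set.uIcc_of_le h2pi]
      exact fun x hx => (hGd x hx).continuousAt.continuousWithinAt)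
    (by
      rw [min_eq_left hs₁, min_eq_left h2pi, max_eq_right hs₁, max_eq_right h2pi]
      exact fun x hx => (hFd x ⟨Set.Ioo_subset_Icc_self hx.1,
        Set.Ioo_subset_Icc_self hx.2⟩).hasFDerivAt)
    (by
      rw [min_eq_left hs₁, min_eq_left h2pi, max_eq_right hs₁, max_eq_right h2pi]
      exact fun x hx => (hGd x ⟨Set.Ioo_subset_Icc_self hx.1,
        Set.Ioo_subset_Icc_self hx.2⟩).hasFDerivAt)
    (by
      rw [Set.uIcc_of_le hs₁, Set.uIcc_of_le h2pi]
      exact integrableOn_zero.congr_fun (fun x hx => (hzero x hx).symm)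
        (measurableSet_Icc.prod measurableSet_Icc))
  have hleft : (∫ x in (0 : ℝ)..s₁, ∫ y in (0 : ℝ)..2 * Real.pi,
      fderiv ℝ F (x, y) (1, 0) + fderiv ℝ G (x, y) (0, 1)) = 0 := by
    refine (intervalIntegral.integral_congr (g := fun _ => 0) fun x hx => ?_).trans (by simp)
    rw [Set.uIcc_of_le hs₁] at hx
    refine (intervalIntegral.integral_congr (g := fun _ => 0) fun y hy => ?_).trans (by simp)
    rw [Set.uIcc_of_le h2pi] at hy
    exact hzero (x, y) ⟨hx, hy⟩
  -- The sides `θ = 0` and `θ = 2π` cancel: `sin (θ / 2)` vanishes at both, so the points differ by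
  -- the period `2πi`.
  have hends : ∀ x, G (x, 2 * Real.pi) = G (x, 0) := by
    intro x
    have : logHomotopy κ (x, 2 * Real.pi) = logHomotopy κ (x, 0) + 2 * Real.pi * Complex.I := by
      simp [logHomotopy]
    simp only [hG]
    rw [this, hper]
    simp
  rw [hleft] at hdiv
  simp only [hends, sub_self, zero_add] at hdiv
  exact (sub_eq_zero.1 hdiv.symm)

lemma norm_exp_logHomotopy_inv_le {κ s θ : ℝ} (h0 : 0 < κ) (hs0 : 0 ≤ s)
    (hθ : θ ∈ Set.Ioo 0 (2 * Real.pi)) :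
    ‖(Complex.exp (logHomotopy κ (s, θ)))⁻¹‖ ≤ 3 := by
  have hs := sin_half_pos hθ
  rw [← Complex.exp_neg, Complex.norm_exp, Complex.neg_re, logHomotopy_re]
  have : 0 ≤ s * κ * Real.sin (θ / 2) := by positivity
  calc _ ≤ Real.exp 1 := Real.exp_le_exp.2 (by simp only; linarith)
    _ ≤ 3 := by linarith [Real.exp_one_lt_d9]

/-- A lower bound uniform in `s`. For `a < 0` it dominates `|1 - w|^a` by `sin (θ / 2) ^ a` while
the curves approach the singular contour. -/
lemma sin_half_le_norm_one_sub_exp_logHomotopy {κ s θ : ℝ} (h0 : 0 < κ) (hs0 : 0 ≤ s)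
    (hθ : θ ∈ Set.Ioo 0 (2 * Real.pi)) :
    Real.sin (θ / 2) ≤ ‖1 - Complex.exp (logHomotopy κ (s, θ))‖ := by
  have hs := sin_half_pos hθ
  have h3 := norm_exp_logHomotopy_inv_le h0 hs0 hθ
  rw [norm_inv, Complex.norm_exp, inv_le_comm₀ (Real.exp_pos _) (by norm_num)] at h3
  refine le_of_sq_le_sq ?_ (norm_nonneg _)
  rw [norm_one_sub_exp_sq, logHomotopy_im]
  nlinarith [sq_nonneg (1 - Real.exp (logHomotopy κ (s, θ)).re),
    mul_le_mul_of_nonneg_right h3 (sq_nonneg (Real.sin (θ / 2)))]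

lemma norm_one_sub_exp_logHomotopy_le {κ s θ : ℝ} (h0 : 0 < κ) (h1 : κ ≤ 1)
    (hs1 : s ≤ 1) (hθ : θ ∈ Set.Ioo 0 (2 * Real.pi)) :
    ‖1 - Complex.exp (logHomotopy κ (s, θ))‖ ≤ 4 := by
  have hs := sin_half_pos hθ
  refine (norm_sub_le _ _).trans ?_
  rw [norm_one, Complex.norm_exp, logHomotopy_re]
  have h2 : κ * Real.sin (θ / 2) ≤ 1 := by nlinarith [Real.sin_le_one (θ / 2)]
  have h3 : s * (κ * Real.sin (θ / 2)) ≤ κ * Real.sin (θ / 2) :=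
    mul_le_of_le_one_left (by positivity) hs1
  have : Real.exp (s - 1 + s * κ * Real.sin (θ / 2)) ≤ Real.exp 1 :=
    Real.exp_le_exp.2 (by linarith)
  linarith [Real.exp_one_lt_d9]

lemma integral_circle_eq_taylorCoeff {f : ℂ → ℂ} (hf : DifferentiableOn ℂ f (Metric.ball 0 1))
    (κ : ℝ) (n : ℕ) :
    ∫ θ in (0 : ℝ)..2 * Real.pi, f (Complex.exp (logHomotopy κ (0, θ))) *
        (Complex.exp (logHomotopy κ (0, θ)))⁻¹ ^ n *
        ((0 * κ * Real.cos (θ / 2) / 2 : ℝ) + Complex.I) =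
      2 * Real.pi * Complex.I * taylorCoeff f n := by
  have hr : (0 : ℝ) < Real.exp (-1) := Real.exp_pos _
  have hr1 : Real.exp (-1) < 1 := by simp
  have := (hf.mono (Metric.closedBall_subset_ball hr1)).circleIntegral_one_div_sub_center_pow_smul
    hr n
  rw [taylorCoeff, ← mul_div_assoc, ← div_mul_eq_mul_div, ← smul_eq_mul (_ / _), ← this,
    circleIntegral]
  refine intervalIntegral.integral_congr fun θ _ => ?_
  have hc : Complex.exp (logHomotopy κ (0, θ)) = circleMap 0 (Real.exp (-1)) θ := by
    simp [logHomotopy, circleMap, Complex.exp_add]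
  have hne : circleMap 0 (Real.exp (-1)) θ ≠ 0 := hc ▸ Complex.exp_ne_zero _
  simp only [hc, deriv_circleMap, smul_eq_mul, sub_zero, inv_pow]
  set w := circleMap 0 (Real.exp (-1)) θ
  field_simp
  simp
  ring

/-- The weight in Cauchy's formula for Taylor coefficients along `spiral κ`. -/
noncomputable def spiralWeight (f : ℂ → ℂ) (κ θ : ℝ) : ℂ :=
  f (spiral κ θ) * ((κ * Real.cos (θ / 2) / 2 : ℝ) + Complex.I) / (2 * Real.pi * Complex.I)

/-- **Cauchy's formula** for the Taylor coefficients along a contour through the singularity `1`. -/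
lemma integral_spiralWeight_eq_taylorCoeff {κ c η a : ℝ} {f : ℂ → ℂ} (h0 : 0 < κ)
    (h2 : 2 * κ ≤ 1) (hc : κ ≤ c / 2) (hη : 4 * κ ≤ η) (ha : -1 < a)
    (hf : AnalyticOnNhd ℂ f (coneDomain c η))
    (hfO : f =O[𝓟 (coneDomain c η)] fun z : ℂ => ‖1 - z‖ ^ a) (n : ℕ) :
    ∫ θ in Set.Ioo 0 (2 * Real.pi), spiralWeight f κ θ * (spiral κ θ)⁻¹ ^ n = taylorCoeff f n := by
  have h1 : κ ≤ 1 := by linarith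
  have h2pi : (0 : ℝ) ≤ 2 * Real.pi := by positivity
  obtain ⟨C, hC0, hC⟩ := hfO.exists_nonneg
  rw [isBigOWith_principal] at hC
  set Φ : ℂ → ℂ := fun u => f (Complex.exp u) * (Complex.exp u)⁻¹ ^ n with hΦ
  have hmem : ∀ s : ℝ, s < 1 → ∀ θ ∈ Set.Icc 0 (2 * Real.pi),
      Complex.exp (logHomotopy κ (s, θ)) ∈ coneDomain c η := fun s hs1 θ hθ =>
    exp_logHomotopy_mem h0 h1 (by linarith) (by linarith) hs1 hθ
  have hd : ∀ u, Complex.exp u ∈ coneDomain c η → DifferentiableAt ℂ Φ u := by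
    intro u hu
    have e1 : DifferentiableAt ℂ Complex.exp u := Complex.differentiable_exp u
    exact ((hf _ hu).differentiableAt.comp u e1).mul ((e1.inv (Complex.exp_ne_zero u)).pow n)
  have hone : ∀ θ, Complex.exp (logHomotopy κ (1, θ)) = spiral κ θ := by
    intro θ
    simp [logHomotopy, spiral]
  set J : ℝ → ℝ → ℂ := fun s θ =>
    Φ (logHomotopy κ (s, θ)) * ((s * κ * Real.cos (θ / 2) / 2 : ℝ) + Complex.I) with hJ
  have hconst : ∀ s : ℝ, 0 ≤ s → s < 1 →
      ∫ θ in Set.Ioo 0 (2 * Real.pi), J s θ = 2 * Real.pi * Complex.I * taylorCoeff f n := by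
    intro s hs0 hs1
    rw [← integral_Ioc_eq_integral_Ioo, ← intervalIntegral.integral_of_le h2pi]
    refine (integral_logHomotopy_eq hs0 (fun u => ?_) fun t ht θ hθ =>
      hd _ (hmem t (ht.2.trans_lt hs1) θ hθ)).trans
      (integral_circle_eq_taylorCoeff (hf.differentiableOn.mono
        (ball_subset_coneDomain (by linarith) (by linarith))) κ n)
    simp only [hΦ, Complex.exp_add, Complex.exp_two_pi_mul_I, mul_one]
  -- Homotopy invariance holds only for `s < 1`, where the closed curve avoids `1`. The singular
  -- contour is reached by dominated convergence, which is where `-1 < a` enters.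
  have hlim : Tendsto (fun s => ∫ θ in Set.Ioo 0 (2 * Real.pi), J s θ) (𝓝[<] 1)
      (𝓝 (∫ θ in Set.Ioo 0 (2 * Real.pi), J 1 θ)) := by
    have hI : ∀ᶠ s : ℝ in 𝓝[<] 1, s ∈ Set.Ioo (0 : ℝ) 1 := Ioo_mem_nhdsLT one_pos
    refine tendsto_integral_filter_of_dominated_convergence
      (fun θ => C * (4 ^ |a| + Real.sin (θ / 2) ^ a) * 3 ^ n * 2) ?_ ?_ ?_ ?_
    · filter_upwards [hI] with s hs
      refine ContinuousOn.aestronglyMeasurable (fun θ hθ => ?_) measurableSet_Ioo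
      refine ContinuousAt.continuousWithinAt (ContinuousAt.mul ?_ (by fun_prop))
      exact ContinuousAt.comp (f := fun θ => logHomotopy κ (s, θ)) (hd _ (hmem s hs.2 θ
        (Set.Ioo_subset_Icc_self hθ))).continuousAt (hasDerivAt_logHomotopy_snd κ s θ).continuousAt
    · filter_upwards [hI] with s hs
      refine ae_restrict_of_forall_mem measurableSet_Ioo fun θ hθ => ?_
      have hsin := sin_half_pos hθ
      have hm := hmem s hs.2 θ (Set.Ioo_subset_Icc_self hθ)
      simp only [hJ, hΦ]
      rw [norm_mul, norm_mul, norm_pow]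
      have b1 := hC _ hm
      have b2 := norm_exp_logHomotopy_inv_le h0 hs.1.le hθ
      have b3 : ‖((s * κ * Real.cos (θ / 2) / 2 : ℝ) : ℂ) + Complex.I‖ ≤ 2 := by
        refine (norm_add_le _ _).trans ?_
        rw [Complex.norm_I, Complex.norm_real, Real.norm_eq_abs, abs_div, abs_mul, abs_mul,
          abs_of_pos hs.1, abs_of_pos h0, abs_two]
        have := Real.abs_cos_le_one (θ / 2)
        have : s * κ ≤ 1 := by nlinarith [hs.1, hs.2]
        have : s * κ * |Real.cos (θ / 2)| ≤ 1 * 1 := by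
          gcongr
        linarith
      rw [Real.norm_of_nonneg (by positivity)] at b1
      have b4 := sin_half_le_norm_one_sub_exp_logHomotopy h0 hs.1.le hθ
      have b5 := norm_one_sub_exp_logHomotopy_le h0 h1 hs.2.le hθ
      gcongr
      refine b1.trans ?_
      gcongr
      rcases le_or_gt 0 a with h | h
      · have : ‖1 - Complex.exp (logHomotopy κ (s, θ))‖ ^ a ≤ 4 ^ |a| := by
          rw [abs_of_nonneg h]
          exact Real.rpow_le_rpow (norm_nonneg _) b5 h
        have : 0 ≤ Real.sin (θ / 2) ^ a := by positivity
        linarith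
      · have : ‖1 - Complex.exp (logHomotopy κ (s, θ))‖ ^ a ≤ Real.sin (θ / 2) ^ a :=
          Real.rpow_le_rpow_of_nonpos hsin b4 h.le
        have : (0 : ℝ) ≤ 4 ^ |a| := by positivity
        linarith
    · have hfin : IntegrableOn (fun _ : ℝ => (4 : ℝ) ^ |a|) (Set.Ioo 0 (2 * Real.pi)) :=
        (continuousOn_const.integrableOn_Icc).mono_set Set.Ioo_subset_Icc_self
      exact (((hfin.add (integrableOn_sin_half_rpow ha)).const_mul C).mul_const _).mul_const _
    · refine ae_restrict_of_forall_mem measurableSet_Ioo fun θ hθ => ?_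
      refine Tendsto.mono_left (ContinuousAt.tendsto ?_) nhdsWithin_le_nhds
      refine ContinuousAt.mul ?_ (by fun_prop)
      refine ContinuousAt.comp (f := fun s => logHomotopy κ (s, θ)) (hd _ ?_).continuousAt
        (hasDerivAt_logHomotopy_fst κ 1 θ).continuousAt
      rw [hone]
      exact spiral_mem_coneDomain h0 h2 hc hη hθ
  have hlim2 : Tendsto (fun s => ∫ θ in Set.Ioo 0 (2 * Real.pi), J s θ) (𝓝[<] 1)
      (𝓝 (2 * Real.pi * Complex.I * taylorCoeff f n)) := by
    refine tendsto_const_nhds.congr' ?_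
    filter_upwards [Ioo_mem_nhdsLT (one_pos : (0 : ℝ) < 1)] with s hs
    exact (hconst s hs.1.le hs.2).symm
  have := tendsto_nhds_unique hlim hlim2
  have hne : 2 * (Real.pi : ℂ) * Complex.I ≠ 0 := Complex.two_pi_I_ne_zero
  rw [← mul_right_inj' hne, ← this, ← integral_const_mul]
  refine integral_congr_ae (ae_of_all _ fun θ => ?_)
  simp only [hJ, hΦ, hone, spiralWeight, one_mul]
  field_simp

lemma spiralData_spiralWeight {κ c η a b : ℝ} {f g : ℂ → ℂ} (h0 : 0 < κ)
    (h2 : 2 * κ ≤ 1) (hc : κ ≤ c / 2) (hη : 4 * κ ≤ η) (hc1 : c ≤ 1) (hη1 : η ≤ 1) (ha : -1 < a)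
    (hf : AnalyticOnNhd ℂ f (coneDomain c η)) (hg : AnalyticOnNhd ℂ g (coneDomain c η))
    (hfO : f =O[𝓟 (coneDomain c η)] fun z : ℂ => ‖1 - z‖ ^ a)
    (hgO : g =O[𝓟 (coneDomain c η)] fun z : ℂ => ‖1 - z‖ ^ b) :
    SpiralData κ c η a b (spiralWeight f κ) g where
  kappa_pos := h0
  kappa_le := h2
  kappa_le_c := hc
  kappa_le_eta := hη
  c_le := hc1
  eta_le := hη1
  lt_a := ha
  continuousOn := by
    refine (ContinuousOn.mul ?_ (Continuous.continuousOn (by fun_prop))).div_const _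
    exact hf.continuousOn.comp (continuous_spiral κ).continuousOn fun θ hθ =>
      spiral_mem_coneDomain h0 h2 hc hη hθ
  exists_bound := by
    obtain ⟨C, hC0, hC⟩ := hfO.exists_nonneg
    rw [isBigOWith_principal] at hC
    refine ⟨C * 4 ^ |a| * 2 / ‖2 * (Real.pi : ℂ) * Complex.I‖, by positivity, fun θ hθ => ?_⟩
    have hs := sin_half_pos hθ
    have hm := spiral_mem_coneDomain h0 h2 hc hη hθ
    have b1 := hC _ hm
    rw [Real.norm_of_nonneg (by positivity)] at b1
    have b2 : ‖1 - spiral κ θ‖ ^ a ≤ 4 ^ |a| * Real.sin (θ / 2) ^ a :=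
      rpow_le_of_comparable (by norm_num) (norm_one_sub_pos hm) hs
        (norm_one_sub_spiral_le h0.le (by linarith) hθ)
        (by linarith [two_mul_sin_le_norm_one_sub_spiral h0.le hθ])
    have b3 : ‖((κ * Real.cos (θ / 2) / 2 : ℝ) : ℂ) + Complex.I‖ ≤ 2 := by
      refine (norm_add_le _ _).trans ?_
      rw [Complex.norm_I, Complex.norm_real, Real.norm_eq_abs, abs_div, abs_mul,
        abs_of_pos h0, abs_two]
      have := Real.abs_cos_le_one (θ / 2)
      have : κ * |Real.cos (θ / 2)| ≤ 1 * 1 := by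
        gcongr
        linarith
      linarith
    rw [spiralWeight, norm_div, norm_mul, div_mul_eq_mul_div]
    refine div_le_div_of_nonneg_right ?_ (norm_nonneg _)
    calc _ ≤ C * (4 ^ |a| * Real.sin (θ / 2) ^ a) * 2 := by
          gcongr
          exact b1.trans (by gcongr)
      _ = _ := by ring
  analytic := hg
  isBigO := hgO

/-! ### Identification with the Hadamard product. -/

lemma hasSum_taylorCoeff {g : ℂ → ℂ} (hg : DifferentiableOn ℂ g (Metric.ball 0 1)) {z : ℂ}
    (hz : ‖z‖ < 1) : HasSum (fun n => taylorCoeff g n * z ^ n) (g z) := by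
  refine Eq.subst (motive := fun u => HasSum u _) (funext fun n => ?_)
    (Complex.hasSum_taylorSeries_on_ball hg (z := z) (by simpa using hz))
  simp only [taylorCoeff, sub_zero, smul_eq_mul]
  ring

lemma summable_norm_taylorCoeff {g : ℂ → ℂ}
    (hg : (FormalMultilinearSeries.ofScalars ℂ (taylorCoeff g)).radius = 1) {r : ℝ}
    (hr0 : 0 ≤ r) (hr : r < 1) : Summable fun n => ‖taylorCoeff g n‖ * r ^ n := by
  lift r to NNReal using hr0
  have := (FormalMultilinearSeries.ofScalars ℂ (taylorCoeff g)).summable_norm_mul_pow (r := r)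
    (by rw [hg]; exact_mod_cast hr)
  simpa only [FormalMultilinearSeries.ofScalars_norm] using this

/-- As `|w| ≥ 1`, the series of `g (z / w)` converges along the whole contour and is dominated by `∑
|gₙ| |z|ⁿ` times the integrable weight. Termwise integration then produces the coefficients of `f`.
-/
lemma hasSum_spiralIntegral {κ c η a b : ℝ} {f g : ℂ → ℂ}
    (H : SpiralData κ c η a b (spiralWeight f κ) g)
    (hf : AnalyticOnNhd ℂ f (coneDomain c η))
    (hfO : f =O[𝓟 (coneDomain c η)] fun z : ℂ => ‖1 - z‖ ^ a)
    (hgr : (FormalMultilinearSeries.ofScalars ℂ (taylorCoeff g)).radius = 1) {z : ℂ}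
    (hz : ‖z‖ < 1) :
    HasSum (fun n : ℕ => taylorCoeff f n * taylorCoeff g n * z ^ n)
      (spiralIntegral κ (spiralWeight f κ) g 0 z) := by
  obtain ⟨K, hK0, hK⟩ := H.exists_bound
  have hsum := summable_norm_taylorCoeff hgr (norm_nonneg z) hz
  have hκ := H.kappa_pos
  have hgd : DifferentiableOn ℂ g (Metric.ball 0 1) := H.analytic.differentiableOn.mono
    (ball_subset_coneDomain (by linarith [H.kappa_le_c]) (by linarith [H.kappa_le_eta]))
  have key := hasSum_integral_of_dominated_convergence
    (μ := volume.restrict (Set.Ioo 0 (2 * Real.pi)))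
    (F := fun n θ => spiralWeight f κ θ * (spiral κ θ)⁻¹ ^ n * (taylorCoeff g n * z ^ n))
    (f := spiralIntegrand κ (spiralWeight f κ) g 0 z)
    (fun n θ => K * Real.sin (θ / 2) ^ a * (‖taylorCoeff g n‖ * ‖z‖ ^ n)) ?_ ?_ ?_ ?_ ?_
  · refine Eq.subst (motive := fun u => HasSum u _) (funext fun n => ?_) key
    rw [integral_mul_const, integral_spiralWeight_eq_taylorCoeff hκ H.kappa_le H.kappa_le_c
      H.kappa_le_eta H.lt_a hf hfO]
    ring
  · intro n
    refine ContinuousOn.aestronglyMeasurable ?_ measurableSet_Ioo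
    refine (H.continuousOn.mul (ContinuousOn.pow ?_ n)).mul continuousOn_const
    exact (continuous_spiral κ).continuousOn.inv₀ fun θ _ => spiral_ne_zero κ θ
  · intro n
    refine ae_restrict_of_forall_mem measurableSet_Ioo fun θ hθ => ?_
    have h3 : ‖(spiral κ θ)⁻¹ ^ n‖ ≤ 1 := by
      rw [norm_pow, norm_inv]
      exact pow_le_one₀ (by positivity) (inv_le_one_of_one_le₀ (one_le_norm_spiral hκ.le hθ))
    have h4 := hK θ hθ
    rw [norm_mul, norm_mul, norm_mul, norm_pow z]
    refine mul_le_mul_of_nonneg_right ?_ (by positivity)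
    exact (mul_le_of_le_one_right (norm_nonneg _) h3).trans h4
  · exact ae_of_all _ fun θ => hsum.mul_left _
  · simp only [tsum_mul_left]
    exact ((integrableOn_sin_half_rpow H.lt_a).const_mul K).mul_const _
  · refine ae_restrict_of_forall_mem measurableSet_Ioo fun θ hθ => ?_
    have h1 : ‖z / spiral κ θ‖ < 1 := by
      rw [norm_div]
      exact (div_le_self (norm_nonneg _) (one_le_norm_spiral hκ.le hθ)).trans_lt hz
    have h2 := (hasSum_taylorCoeff hgd h1).mul_left (spiralWeight f κ θ)
    simp only [spiralIntegrand, pow_zero, mul_one, iteratedDeriv_zero]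
    refine Eq.subst (motive := fun u => HasSum u _) (funext fun n => ?_) h2
    rw [div_eq_mul_inv, mul_pow]
    ring

/-- An analytic continuation `H 0` of the Hadamard product to `coneDomain c η`, its derivatives
`H j`, their limits `d j` at `1`, and their growth at `1`. -/
structure HadamardContinuation (f g : ℂ → ℂ) (c η s : ℝ) (H : ℕ → ℂ → ℂ) (d : ℕ → ℂ) : Prop where
  hasSum : ∀ z ∈ Metric.ball (0 : ℂ) 1,
    HasSum (fun n : ℕ => taylorCoeff f n * taylorCoeff g n * z ^ n) (H 0 z)
  hasDerivAt : ∀ j, ∀ z ∈ coneDomain c η, HasDerivAt (H j) (H (j + 1) z) z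
  iteratedDeriv_eq : ∀ j, ∀ z ∈ coneDomain c η, iteratedDeriv j (H 0) z = H j z
  tendsto : ∀ j : ℕ, (j : ℝ) < s → Tendsto (H j) (𝓝[coneDomain c η] 1) (𝓝 (d j))
  bound_rpow : ∀ j : ℕ, s < j → ∃ C : ℝ, 0 ≤ C ∧ ∀ z ∈ coneDomain c η,
    ‖H j z‖ ≤ C * ‖1 - z‖ ^ (s - j)
  bound_log : ∀ j : ℕ, s = j → ∃ C : ℝ, 0 ≤ C ∧ ∀ z ∈ coneDomain c η,
    ‖H j z‖ ≤ C * (5 - Real.log ‖1 - z‖)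

lemma HadamardContinuation.symm {f g : ℂ → ℂ} {c η s : ℝ} {H : ℕ → ℂ → ℂ} {d : ℕ → ℂ}
    (h : HadamardContinuation f g c η s H d) : HadamardContinuation g f c η s H d :=
  { h with hasSum := fun z hz => by simpa only [mul_comm] using h.hasSum z hz }

lemma exists_hadamardContinuation {c η a b : ℝ} {f g : ℂ → ℂ} (hc : 0 < c) (hc1 : c ≤ 1)
    (hη : 0 < η) (hη1 : η ≤ 1)
    (hf : AnalyticOnNhd ℂ f (coneDomain c η)) (hg : AnalyticOnNhd ℂ g (coneDomain c η))
    (hfr : (FormalMultilinearSeries.ofScalars ℂ (taylorCoeff f)).radius = 1)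
    (hgr : (FormalMultilinearSeries.ofScalars ℂ (taylorCoeff g)).radius = 1)
    (hfO : f =O[𝓟 (coneDomain c η)] fun z : ℂ => ‖1 - z‖ ^ a)
    (hgO : g =O[𝓟 (coneDomain c η)] fun z : ℂ => ‖1 - z‖ ^ b) (hab : -1 < a + b + 1) :
    ∃ c' η' : ℝ, 0 < c' ∧ c' ≤ c ∧ 0 < η' ∧ η' ≤ η ∧ ∃ H d,
      HadamardContinuation f g c' η' (a + b + 1) H d := by
  -- If `a ≤ -1`, then `a + b > -2` forces `b > -1`, and the roles of `f` and `g` can be exchanged.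
  wlog ha : -1 < a generalizing f g a b
  · obtain ⟨c', η', h1, h2, h3, h4, H, d, h⟩ := this hg hf hgr hfr hgO hfO (by linarith)
      (by linarith)
    rw [add_comm b a] at h
    exact ⟨c', η', h1, h2, h3, h4, H, d, h.symm⟩
  set κ : ℝ := min (c / 2) (η / 4) with hκ
  have h0 : 0 < κ := by positivity
  have hκc : κ ≤ c / 2 := min_le_left _ _
  have hκη : κ ≤ η / 4 := min_le_right _ _
  have D := spiralData_spiralWeight h0 (by linarith) hκc (by linarith) hc1 hη1 ha hf hg hfO hgO
  -- These are the parameters of `coneDomain_subset_spiralSet` at `κ / 2`, the slope allowed for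
  -- `z`.
  set c' := κ / 2 / 16 with hc'
  set η' := (κ / 2) ^ 2 / 16 with hη'
  have hη'0 : 0 < η' := by positivity
  have hη'η : η' ≤ η := by nlinarith
  have hsub : coneDomain c' η' ⊆ spiralSet (κ / 2) :=
    coneDomain_subset_spiralSet (by linarith) (by linarith)
  have hone := one_notMem_coneDomain c' η'
  have hne : ∀ z ∈ coneDomain c' η', z ≠ 1 := fun z hz h => hone (h ▸ hz)
  refine ⟨c', η', by positivity, by linarith, hη'0, hη'η, spiralIntegral κ (spiralWeight f κ) g,
    fun j => spiralIntegral κ (spiralWeight f κ) g j 1, ?_, ?_, ?_, ?_, ?_, ?_⟩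
  · intro z hz
    exact hasSum_spiralIntegral D hf hfO hgr (by simpa using hz)
  · exact fun j z hz => D.hasDerivAt_spiralIntegral j (isOpen_coneDomain _ _) hsub hone hz
  · exact fun j z hz => D.iteratedDeriv_spiralIntegral (isOpen_coneDomain _ _) hsub hone j z hz
  · exact fun j hj => D.tendsto_spiralIntegral hsub hj
  · intro j hj
    obtain ⟨C, hC0, hC⟩ := D.norm_spiralIntegral_le j
    obtain ⟨C', hC'0, hC'⟩ := exists_integral_le_rpow (p := b - j) ha (by linarith)
    refine ⟨C * C', by positivity, fun z hz => (hC z (hsub hz) (hne z hz)).trans ?_⟩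
    rw [mul_assoc, show a + b + 1 - j = a + (b - j) + 1 by ring]
    gcongr
    exact hC' _ (norm_one_sub_pos hz) (norm_one_sub_le_three (by linarith) hz)
  · intro j hj
    obtain ⟨C, hC0, hC⟩ := D.norm_spiralIntegral_le j
    obtain ⟨C', hC'0, hC'⟩ := exists_integral_le_log (p := b - j) ha (by linarith)
    refine ⟨C * C', by positivity, fun z hz => (hC z (hsub hz) (hne z hz)).trans ?_⟩
    rw [mul_assoc]
    gcongr
    exact hC' _ (norm_one_sub_pos hz) (norm_one_sub_le_three (by linarith) hz)

/-- `L` vanishes at `0`, so `|z| ≥ r` is needed to absorb the constant. If `|L| ≤ 1`, then `r / 3 ≤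
|z / (1 - z)| = |e^L - 1| ≤ 2 |L|`, which gives `r / 6`. -/
lemma five_sub_log_le {r : ℝ} (hr : 0 < r) : ∃ C : ℝ, 0 ≤ C ∧ ∀ z : ℂ, r ≤ ‖z‖ →
    0 < ‖1 - z‖ → ‖1 - z‖ ≤ 3 → 5 - Real.log ‖1 - z‖ ≤ C * ‖L z‖ := by
  set m := min 1 (r / 6) with hm
  have hm0 : 0 < m := by positivity
  refine ⟨5 / m + 1, by positivity, fun z hz h0 h3 => ?_⟩
  have hne : 1 - z ≠ 0 := norm_pos_iff.1 h0
  have h1 : -Real.log ‖1 - z‖ ≤ ‖L z‖ := by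
    refine le_trans (le_of_eq ?_) (Complex.re_le_norm _)
    rw [L, Complex.log_re, one_div, norm_inv, Real.log_inv]
  have h2 : m ≤ ‖L z‖ := by
    rcases le_or_gt ‖L z‖ 1 with h | h
    · have h4 := Complex.norm_exp_sub_one_le h
      rw [L, Complex.exp_log (one_div_ne_zero hne), ← L] at h4
      have h5 : 1 / (1 - z) - 1 = z / (1 - z) := by field_simp; ring
      rw [h5, norm_div, div_le_iff₀ h0] at h4
      have h6 : 2 * ‖L z‖ * ‖1 - z‖ ≤ 2 * ‖L z‖ * 3 := by gcongr
      exact (min_le_right _ _).trans (by linarith)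
    · exact (min_le_left _ _).trans h.le
  have h7 : 5 ≤ 5 / m * ‖L z‖ := by
    rw [div_mul_eq_mul_div, le_div_iff₀ hm0]
    linarith
  linarith

end HadamardSing

/-! ### Assembly of the theorem. -/

open HadamardSing in
theorem mainTheorem3 (f g : ℂ → ℂ) (φ η a b : ℝ)
    (hf : IsDeltaRegular f φ η) (hg : IsDeltaRegular g φ η)
    (hfO : f =O[𝓟 (deltaDomain φ η)] fun z : ℂ => ‖1 - z‖ ^ a)
    (hgO : g =O[𝓟 (deltaDomain φ η)] fun z : ℂ => ‖1 - z‖ ^ b)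
    (hab : -1 < a + b + 1) :
    ∃ (φ' η' : ℝ) (h : ℂ → ℂ),
      φ ≤ φ' ∧ φ' < Real.pi / 2 ∧ 0 < η' ∧ η' ≤ η ∧
      IsHadamardProductOn f g h (deltaDomain φ' η') ∧
      (∀ k : ℤ, -1 ≤ k → (k : ℝ) < a + b + 1 → a + b + 1 < (k : ℝ) + 1 →
        ∃ d : ℕ → ℂ,
          (∀ j : ℕ, (j : ℤ) ≤ k → HasDerivValueAtOne h (deltaDomain φ' η') j (d j)) ∧
          (fun z => h z - taylorPolyAtOne d (k + 1).toNat z)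
            =O[𝓟 (deltaDomain φ' η')] fun z : ℂ => ‖1 - z‖ ^ (a + b + 1)) ∧
      (∀ m : ℕ, a + b + 1 = (m : ℝ) →
        ∃ d : ℕ → ℂ,
          (∀ j : ℕ, j < m → HasDerivValueAtOne h (deltaDomain φ' η') j (d j)) ∧
          ∀ r : ℝ, 0 < r →
            (fun z => h z - taylorPolyAtOne d m z)
              =O[𝓟 (deltaDomain φ' η' \ Metric.ball 0 r)]
                fun z : ℂ => ‖1 - z‖ ^ (a + b + 1) * ‖L z‖) := by
  have hφ0 := hf.phi_pos
  have hφ := hf.phi_lt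
  have hη := hf.eta_pos
  have hc : 0 < Real.cos φ := Real.cos_pos_of_mem_Ioo ⟨by linarith, hφ⟩
  have hsub : coneDomain (Real.cos φ) (min η 1) ⊆ deltaDomain φ η := by
    rw [deltaDomain_eq_coneDomain hφ0.le (by linarith)]
    exact coneDomain_mono le_rfl (min_le_left _ _)
  obtain ⟨c', η', hc'0, hc'c, hη'0, hη'η, H, d, hH⟩ := exists_hadamardContinuation hc
    (Real.cos_le_one φ) (lt_min hη one_pos) (min_le_right _ _) (hf.analytic.mono hsub)
    (hg.analytic.mono hsub) hf.radius_eq hg.radius_eq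
    (hfO.mono (principal_mono.2 hsub)) (hgO.mono (principal_mono.2 hsub)) hab
  have hc'1 : c' ≤ 1 := hc'c.trans (Real.cos_le_one φ)
  have hη'1 : η' ≤ 1 := hη'η.trans (min_le_right _ _)
  -- Hence the witness `φ' = arccos c'`; `0 < c' ≤ cos φ` gives `φ ≤ φ' < π/2`.
  have hdom : deltaDomain (Real.arccos c') η' = coneDomain c' η' := by
    rw [deltaDomain_eq_coneDomain (Real.arccos_nonneg _) (Real.arccos_le_pi _),
      Real.cos_arccos (by linarith) hc'1]
  have hval : ∀ j : ℕ, (j : ℝ) < a + b + 1 → HasDerivValueAtOne (H 0) (coneDomain c' η') j (d j) := by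
    intro j hj
    refine (hH.tendsto j hj).congr' ?_
    filter_upwards [self_mem_nhdsWithin] with z hz using (hH.iteratedDeriv_eq j z hz).symm
  refine ⟨Real.arccos c', η', H 0, ?_, Real.arccos_lt_pi_div_two.2 hc'0, hη'0,
    hη'η.trans (min_le_left _ _), ?_, ?_, ?_⟩
  · rw [← Real.arccos_cos hφ0.le (by linarith)]
    exact Real.arccos_le_arccos hc'c
  · rw [hdom]
    refine ⟨?_, hH.hasSum⟩
    exact DifferentiableOn.analyticOnNhd (fun z hz =>
      (hH.hasDerivAt 0 z hz).differentiableAt.differentiableWithinAt) (isOpen_coneDomain _ _)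
  · intro k hk hk1 hk2
    rw [hdom]
    -- `M = k + 1` is the first order above `a + b + 1`, so the exponent `a + b + 1 - M` lies in
    -- `(-1, 0)`: the `M`-th derivative may blow up but is integrable along segments. For `k = -1`
    -- nothing is subtracted.
    set M := (k + 1).toNat with hM
    have hMk : (M : ℤ) = k + 1 := Int.toNat_of_nonneg (by linarith)
    have hMk' : (M : ℝ) = k + 1 := by exact_mod_cast hMk
    refine ⟨d, fun j hj => hval j (lt_of_le_of_lt (by exact_mod_cast hj) hk1), ?_⟩
    obtain ⟨C, -, hC⟩ := exists_norm_sub_taylorPolyAtOne_le hη'0 hη'1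
      (slowGrowth_rpow (q := a + b + 1 - M) (by linarith)) M H d hH.hasDerivAt
      (fun j hj => hH.tendsto j (by
        have : (j : ℝ) + 1 ≤ M := by exact_mod_cast hj
        linarith))
      (hH.bound_rpow M (by linarith))
    refine IsBigO.of_bound C (eventually_principal.2 fun z hz => (hC z hz).trans (le_of_eq ?_))
    have h0 := norm_one_sub_pos hz
    rw [Real.norm_of_nonneg (by positivity), ← Real.rpow_natCast, ← Real.rpow_add h0]
    congr 2
    ring
  · intro m hm
    rw [hdom]
    refine ⟨d, fun j hj => hval j (by rw [hm]; exact_mod_cast hj), fun r hr => ?_⟩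
    obtain ⟨C, hC0, hC⟩ := exists_norm_sub_taylorPolyAtOne_le hη'0 hη'1
      slowGrowth_log m H d hH.hasDerivAt
      (fun j hj => hH.tendsto j (by rw [hm]; exact_mod_cast hj)) (hH.bound_log m hm)
    obtain ⟨C', -, hC'⟩ := five_sub_log_le hr
    refine IsBigO.of_bound (C * C') (eventually_principal.2 fun z hz => (hC z hz.1).trans ?_)
    have h0 := norm_one_sub_pos hz.1
    have h1 := hC' z (by simpa using hz.2) h0 (norm_one_sub_le_three hη'1 hz.1)
    rw [Real.norm_of_nonneg (by positivity), hm, Real.rpow_natCast]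
    calc _ ≤ C * (‖1 - z‖ ^ m * (C' * ‖L z‖)) := by gcongr
      _ = _ := by ring
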